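/- All posets are finite. A prime power $p^r$ ($p$ prime, $r\ge 1$) exactly divides an integer $n$, written $p^r\parallel n$, if $p^r\mid n$ and $p^{r+1}\nmid n$. Put $b(2)=1$, $b(3)=b(4)=b(5)=b(7)=3$ and $b(p^r)=2$ for every other prime power $p^r$. Weights. Let $\sigma$ be a permutation of order $n$ of a finite set, and let $\alpha$ be a non-trivial cycle in the disjoint cycle decomposition of $\sigma$, of length $l=p_1^{r_1}\cdots p_k^{r_k}\ge 2$ with distinct primes $p_i$ and $r_i\ge 1$. For each prime power $q$ the weight $w_q(\alpha)\in\mathbb{R}_{\ge 0}$ depends only on $q,l,n$, and is given by the following rules, every weight not mentioned being $0$. (i) If $l=6$: $w_3(\alpha)=2$ if $3\parallel n$; $w_2(\alpha)=3$ if $3\nparallel n$ and $2\parallel n$; $w_4(\alpha)=\frac32$ if $3\nparallel n$ and $2\nparallel n$. (ii) If $l=12$: $w_3(\alpha)=4$ if $3\parallel n$; $w_4(\alpha)=3$ if $3\nparallel n$. (iii) If $l=2p$ with $p\in\{5,7\}$: $w_p(\alpha)=\frac{2(p-1)}{p}$; moreover $w_2(\alpha)=1$ if $2\parallel n$, and $w_4(\alpha)=\frac12$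 if $2\nparallel n$. (iv) If $l\notin\{6,10,12,14\}$: for each $1\le i\le k$, $w_{p_i^{r_i}}(\alpha)=\frac1k\prod_{j\ne i}p_j^{r_j}$, unless $p_i^{r_i}=2$ and $2\nparallel n$, in which case $w_2(\alpha)=0$ and $w_4(\alpha)=\frac1{2k}\prod_{j\neq i}p_j^{r_j}$. Theorem. Let $n\ge 1$, let $P$ be a poset whose automorphism group $\mathrm{Aut}(P)$ is cyclic of order $n$, generated by $g$, and let sums over $\alpha\in g$ run over the non-trivial cycles of $g$, regarded as a permutation of order $n$ of $P$. Let $p^r$ be a prime power with $p^r\parallel n$. 1. If $p^r\ne 2,4$, then $\sum_{\alpha\in g}w_{p^r}(\alpha)\ge b(p^r)$. 2. If $3\nparallel n$ and $p^r\in\{2,4\}$, then also $\sum_{\alpha\in g}w_{p^r}(\alpha)\ge b(p^r)$. 3. If $3\parallel n$ and $2\parallel n$, then $\sum_{\alpha\in g}\bigl(2w_2(\alpha)+3w_3(\alpha)\bigr)\ge 2b(2)+3b(3)=11$. 4. If $3\parallel n$ and $4\parallel n$, then $\sum_{\alpha\in g}\bigl(4w_4(\alpha)+3w_3(\alpha)\bigr)\ge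 4b(4)+3b(3)-1=20$. -/

import Mathlib

namespace PosetAut

/-- `q` is a prime power `p ^ r`, `r ≥ 1`, which exactly divides `n`:
`p ^ r` divides `n` and `p ^ (r + 1)` does not. -/
def ExactDvd (q n : ℕ) : Prop :=
  ∃ p r : ℕ, p.Prime ∧ 1 ≤ r ∧ q = p ^ r ∧ p ^ r ∣ n ∧ ¬ p ^ (r + 1) ∣ n

/-- The function `b` on prime powers (and `1`); its values at other numbers are never used. -/
def b (q : ℕ) : ℕ :=
  if q = 1 then 0
  else if q = 2 then 1
  else if q = 3 ∨ q = 4 ∨ q = 5 ∨ q = 7 then 3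
  else 2

open Classical in
/-- General rule for the weight of `q` in a cycle of length `l = p₁ ^ r₁ ⋯ p_k ^ r_k` of a
permutation of order `n`. If `q = pᵢ ^ rᵢ` then the weight is `(l / q) / k`, where
`l / q = ∏_{j ≠ i} pⱼ ^ rⱼ`; except that if `pᵢ ^ rᵢ = 2` and `2` does not exactly divide `n`,
then `2` has weight `0` and `4` has weight `(l / 2) / (2 * k)`.
All other prime powers have weight `0`. -/
noncomputable def generalWeight (n l q : ℕ) : ℝ :=
  if ExactDvd 2 l ∧ ¬ ExactDvd 2 n ∧ q = 2 then 0
  else if ExactDvd 2 l ∧ ¬ ExactDvd 2 n ∧ q = 4 then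
    ((l : ℝ) / 2) / (2 * (l.primeFactors.card : ℝ))
  else if ExactDvd q l then ((l : ℝ) / (q : ℝ)) / (l.primeFactors.card : ℝ)
  else 0

open Classical in
/-- Rule for cycles of length `6`. -/
noncomputable def weightSix (n q : ℕ) : ℝ :=
  if ExactDvd 3 n then (if q = 3 then 2 else 0)
  else if ExactDvd 2 n then (if q = 2 then 3 else 0)
  else (if q = 4 then 3 / 2 else 0)

open Classical in
/-- Rule for cycles of length `12`. -/
noncomputable def weightTwelve (n q : ℕ) : ℝ :=
  if ExactDvd 3 n then (if q = 3 then 4 else 0)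
  else (if q = 4 then 3 else 0)

open Classical in
/-- Rule for cycles of length `2 * p`, used for `p = 5` and `p = 7`. -/
noncomputable def weightTwice (n p q : ℕ) : ℝ :=
  if q = p then 2 * ((p : ℝ) - 1) / (p : ℝ)
  else if ExactDvd 2 n then (if q = 2 then 1 else 0)
  else (if q = 4 then 1 / 2 else 0)

/-- The weight of the prime power `q` in a cycle of length `l` (with `l ≥ 2`) of a permutation
of order `n`. -/
noncomputable def weight (n l q : ℕ) : ℝ :=
  if l = 6 then weightSix n q
  else if l = 12 then weightTwelve n q
  else if l = 10 then weightTwice n 5 q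
  else if l = 14 then weightTwice n 7 q
  else generalWeight n l q

/-- The weight `w_q(α)` of the prime power `q` in a non-trivial cycle `α` of a permutation of
order `n`; the length of `α` is the number of points that it moves. -/
noncomputable def cycleWeight {X : Type*} [Fintype X] [DecidableEq X]
    (n q : ℕ) (α : Equiv.Perm X) : ℝ :=
  weight n α.support.card q

/-- The set of the (non-trivial) cycles of an automorphism of a finite poset. -/
def cycles {P : Type*} [PartialOrder P] [Fintype P] [DecidableEq P] (g : P ≃o P) :
    Finset (Equiv.Perm P) :=
  Equiv.Perm.cycleFactorsFinset (g.toEquiv : Equiv.Perm P)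

end PosetAut

namespace PosetAut

open Equiv Equiv.Perm Function

/-! ### Exponents modulo the period of a point -/

section Period

variable {P : Type*} (σ : Perm P)

/-! As `g` generates the automorphism group, every automorphism commutes with `g`; on a finite poset
so does every injective monotone self-map. Hence a cycle structure is excluded once it admits an
injective monotone map that does not commute with `g`. Such maps can be built by hand because every
cycle is an antichain and the truth of `σ ^ i x ≤ σ ^ j y` depends only on `i - j` modulo the gcd of
the two periods.

Three constructions are used. Swapping two points of a cycle at distance `l / p` shows that a cycle
of length `l > 2` divisible by the full power of `p` in `n` has a companion divisible by that power
(`exists_cycle_ne`). For `q = 3, 5, 7`, an affine map modulo `q` on two cycles whose lengths have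
gcd `q` forces a third length divisible by `q` (`exists_third_cycle`); it exists because every
subset of `ZMod q` is mapped into itself by an affine bijection that is not a translation. For two
cycles of length `4`, with no other length divisible by `4`, reflections force two further cycles of
length congruent to `2` modulo `4` (`exists_two_cycles_of_four`).

The rest is counting. In the general rule `q` has weight `share m` with `m = l / q`, which is at
least `1`, at least `3 / 2` for `m ≥ 3` and at least `2` for `m ≥ 4`; the lengths `6, 10, 12, 14`
have their own rules. When `3` exactly divides `n`, cycles of length `6` and `12` give nothing to
`2` and `4`, but they then give so much to `3` that the joint sums stay large (`eleven_le_sum`,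
`twenty_le_sum`). -/

theorem zpow_apply_eq_iff (x : P) (i j : ℤ) :
    (σ ^ i) x = (σ ^ j) x ↔ (minimalPeriod σ x : ℤ) ∣ i - j := by
  have h : (σ ^ (i - j)) x = x ↔ (minimalPeriod σ x : ℤ) ∣ i - j :=
    MulAction.zpow_smul_eq_iff_minimalPeriod_dvd (a := σ) (b := x)
  rw [← h, sub_eq_neg_add, zpow_add, zpow_neg, Perm.mul_apply, Perm.inv_eq_iff_eq]

/-- Lets the order arguments use periods, which also cover fixed points (period `1`), while the
weights use supports of cycles. -/
theorem minimalPeriod_eq_card_support [Fintype P] [DecidableEq P] {α : Perm P}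
    (hα : α ∈ σ.cycleFactorsFinset) {x : P} (hx : x ∈ α.support) :
    minimalPeriod σ x = α.support.card := by
  have h := isCycleOn_support_of_mem_cycleFactorsFinset hα
  apply Nat.dvd_antisymm
  · have h1 := (h.zpow_apply_eq (n := (α.support.card : ℤ)) hx).2 dvd_rfl
    have h2 := (zpow_apply_eq_iff σ x (α.support.card : ℤ) 0).1 (by simpa using h1)
    rw [sub_zero] at h2
    exact_mod_cast h2
  · have h1 := (zpow_apply_eq_iff σ x (minimalPeriod σ x : ℤ) 0).2 (by simp)
    have h2 := (h.zpow_apply_eq (n := (minimalPeriod σ x : ℤ)) hx).1 (by simpa using h1)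
    exact_mod_cast h2

theorem minimalPeriod_of_sameCycle {x y : P} (h : σ.SameCycle x y) :
    minimalPeriod σ x = minimalPeriod σ y := by
  have key : ∀ i : ℤ, (σ ^ i) x = x ↔ (σ ^ i) y = y := by
    obtain ⟨k, rfl⟩ := h
    intro i
    rw [← Perm.mul_apply, ← zpow_add, add_comm, zpow_add, Perm.mul_apply,
      EmbeddingLike.apply_eq_iff_eq]
  have key' : ∀ i : ℤ, (minimalPeriod σ x : ℤ) ∣ i ↔ (minimalPeriod σ y : ℤ) ∣ i := by
    intro i
    have h1 := zpow_apply_eq_iff σ x i 0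
    have h2 := zpow_apply_eq_iff σ y i 0
    simp only [zpow_zero, Perm.one_apply, sub_zero] at h1 h2
    rw [← h1, ← h2, key]
  apply Nat.dvd_antisymm
  · exact_mod_cast (key' _).2 dvd_rfl
  · exact_mod_cast (key' _).1 dvd_rfl

end Period

/-- A permutation of a poset which is monotone together with its inverse and which commutes with
every injective monotone self-map. -/
structure IsCentralAut {P : Type*} [PartialOrder P] (σ : Perm P) : Prop where
  le_iff : ∀ (i : ℤ) (x y : P), (σ ^ i) x ≤ (σ ^ i) y ↔ x ≤ y
  comm : ∀ f : P → P, Injective f → Monotone f → ∀ x, f (σ x) = σ (f x)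

/-- An injective monotone self-map of a finite poset is an automorphism. -/
noncomputable def orderIsoOfInjective {P : Type*} [PartialOrder P] [Finite P] (f : P → P)
    (hf : Injective f) (hm : Monotone f) : P ≃o P where
  toEquiv := Equiv.ofBijective f (Finite.injective_iff_bijective.1 hf)
  map_rel_iff' := by
    intro x y
    refine ⟨fun h => ?_, fun h => hm h⟩
    set τ : Perm P := Equiv.ofBijective f (Finite.injective_iff_bijective.1 hf) with hτ
    have hmono : ∀ k : ℕ, Monotone (τ ^ k : Perm P) := by
      intro k
      rw [Perm.coe_pow]
      exact Monotone.iterate hm k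
    obtain ⟨k, hk, hk1⟩ := isOfFinOrder_iff_pow_eq_one.1 (isOfFinOrder_of_finite τ)
    -- With `τ ^ (k + 1) = 1`, the inverse of `τ` is the iterate `τ ^ k`, which is monotone.
    obtain ⟨k, rfl⟩ : ∃ j, k = j + 1 := ⟨k - 1, by omega⟩
    have := hmono k h
    rw [← Perm.mul_apply, ← Perm.mul_apply, ← pow_succ, hk1] at this
    exact this

theorem isCentralAut_of_zpowers_eq_top {P : Type*} [PartialOrder P] [Finite P] (g : P ≃o P)
    (hg : Subgroup.zpowers g = ⊤) : IsCentralAut (g.toEquiv : Perm P) := by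
  have hz : ∀ i : ℤ, ((g.toEquiv : Perm P) ^ i) = (g ^ i).toEquiv := by
    let φ : (P ≃o P) →* Perm P :=
      { toFun := fun h => h.toEquiv, map_one' := rfl, map_mul' := fun _ _ => rfl }
    exact fun i => (map_zpow φ g i).symm
  refine ⟨fun i x y => ?_, fun f hf hm x => ?_⟩
  · rw [hz]
    exact (g ^ i).le_iff_le
  · obtain ⟨k, hk⟩ : orderIsoOfInjective f hf hm ∈ Subgroup.zpowers g := by
      rw [hg]; trivial
    have hk : g ^ k = orderIsoOfInjective f hf hm := hk
    have : orderIsoOfInjective f hf hm * g = g * orderIsoOfInjective f hf hm := by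
      rw [← hk, ← zpow_add_one, ← zpow_one_add, add_comm]
    exact congrArg (fun h : P ≃o P => h x) this

/-! ### Order relations between cycles, and maps that must commute with `σ` -/

section Central

variable {P : Type*} [PartialOrder P] {σ : Perm P}

/-- Applying `σ ^ i` repeatedly to `x ≤ σ ^ i x` gives an ascending chain that returns to `x`, so
cycles are antichains. -/
theorem IsCentralAut.eq_of_le_of_sameCycle [Finite P] (hσ : IsCentralAut σ) {x y : P}
    (hxy : x ≤ y) (h : σ.SameCycle x y) : x = y := by
  obtain ⟨i, rfl⟩ := h
  refine le_antisymm hxy ?_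
  obtain ⟨k, hk, hk1⟩ := isOfFinOrder_iff_pow_eq_one.1 (isOfFinOrder_of_finite (σ ^ i))
  obtain ⟨k, rfl⟩ : ∃ j, k = j + 1 := ⟨k - 1, by omega⟩
  have key : ∀ j : ℕ, (σ ^ i) x ≤ ((σ ^ i) ^ (j + 1)) x := by
    intro j
    induction j with
    | zero => simp
    | succ j ih =>
      refine ih.trans ?_
      rw [pow_succ _ (j + 1), Perm.mul_apply, ← zpow_natCast, ← zpow_mul, hσ.le_iff]
      exact hxy
  simpa [hk1] using key k

theorem IsCentralAut.le_shift (hσ : IsCentralAut σ) {x y : P} (hxy : x ≤ y) {i j : ℤ}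
    (h : (Nat.gcd (minimalPeriod σ x) (minimalPeriod σ y) : ℤ) ∣ i - j) :
    (σ ^ i) x ≤ (σ ^ j) y := by
  obtain ⟨t, ht⟩ := h
  rw [Nat.gcd_eq_gcd_ab] at ht
  set u := Nat.gcdA (minimalPeriod σ x) (minimalPeriod σ y)
  set v := Nat.gcdB (minimalPeriod σ x) (minimalPeriod σ y)
  -- By Bézout this one exponent is congruent to `i` modulo the period of `x` and to `j` modulo that
  -- of `y`, so a single power of `σ` moves both points as required.
  have h1 : (σ ^ i) x = (σ ^ (i - minimalPeriod σ x * (u * t))) x := by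
    rw [zpow_apply_eq_iff]
    exact ⟨u * t, by ring⟩
  have h2 : (σ ^ j) y = (σ ^ (i - minimalPeriod σ x * (u * t))) y := by
    rw [zpow_apply_eq_iff]
    exact ⟨-(v * t), by linear_combination -ht⟩
  rw [h1, h2, hσ.le_iff]
  exact hxy

theorem IsCentralAut.le_shift_iff (hσ : IsCentralAut σ) {x y : P} {i j i' j' : ℤ}
    (h : (Nat.gcd (minimalPeriod σ x) (minimalPeriod σ y) : ℤ) ∣ (i - j) - (i' - j')) :
    (σ ^ i) x ≤ (σ ^ j) y ↔ (σ ^ i') x ≤ (σ ^ j') y := by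
  have key : ∀ {i j i' j' : ℤ},
      (Nat.gcd (minimalPeriod σ x) (minimalPeriod σ y) : ℤ) ∣ (i - j) - (i' - j') →
      (σ ^ i) x ≤ (σ ^ j) y → (σ ^ i') x ≤ (σ ^ j') y := by
    intro i j i' j' h hle
    have hx := minimalPeriod_of_sameCycle σ (⟨i, rfl⟩ : σ.SameCycle x ((σ ^ i) x))
    have hy := minimalPeriod_of_sameCycle σ (⟨j, rfl⟩ : σ.SameCycle y ((σ ^ j) y))
    have := hσ.le_shift hle (i := i' - i) (j := j' - j) (by
      rw [← hx, ← hy]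
      have h' := dvd_neg.2 h
      rwa [show -((i - j) - (i' - j')) = (i' - i) - (j' - j) by ring] at h')
    rwa [← Perm.mul_apply, ← Perm.mul_apply, ← zpow_add, ← zpow_add, sub_add_cancel,
      sub_add_cancel] at this
  exact ⟨key h, key ((dvd_neg.2 h).trans (by rw [neg_sub]))⟩

/-- Moving the points of two cycles by `φ` and `ψ` and fixing all other points: if this preserves
the order, then it commutes with `σ`. -/
theorem IsCentralAut.map_add_one [Finite P] (hσ : IsCentralAut σ) {a b : P}
    (hab : ¬ σ.SameCycle a b) (φ ψ : ℤ → ℤ)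
    (hφ : ∀ i j, (minimalPeriod σ a : ℤ) ∣ φ i - φ j ↔ (minimalPeriod σ a : ℤ) ∣ i - j)
    (hψ : ∀ i j, (minimalPeriod σ b : ℤ) ∣ ψ i - ψ j ↔ (minimalPeriod σ b : ℤ) ∣ i - j)
    (ha : ∀ z i, ¬ σ.SameCycle a z → ¬ σ.SameCycle b z →
      ((σ ^ i) a ≤ z → (σ ^ φ i) a ≤ z) ∧ (z ≤ (σ ^ i) a → z ≤ (σ ^ φ i) a))
    (hb : ∀ z i, ¬ σ.SameCycle a z → ¬ σ.SameCycle b z →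
      ((σ ^ i) b ≤ z → (σ ^ ψ i) b ≤ z) ∧ (z ≤ (σ ^ i) b → z ≤ (σ ^ ψ i) b))
    (hle : ∀ i j, (σ ^ i) a ≤ (σ ^ j) b → (σ ^ φ i) a ≤ (σ ^ ψ j) b)
    (hnle : ∀ i j : ℤ, ¬ (σ ^ j) b ≤ (σ ^ i) a) (i : ℤ) :
    (minimalPeriod σ a : ℤ) ∣ φ (i + 1) - (φ i + 1) := by
  classical
  -- The chosen exponent is determined only modulo the period; `hφ` and `hψ` make the value
  -- independent of the choice and `f` injective.
  let f : P → P := fun x =>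
    if h : σ.SameCycle a x then (σ ^ φ h.choose) a
    else if h : σ.SameCycle b x then (σ ^ ψ h.choose) b else x
  have fa : ∀ i : ℤ, f ((σ ^ i) a) = (σ ^ φ i) a := by
    intro i
    have h : σ.SameCycle a ((σ ^ i) a) := ⟨i, rfl⟩
    simp only [f, dif_pos h]
    rw [zpow_apply_eq_iff, hφ, ← zpow_apply_eq_iff]
    exact h.choose_spec
  have fb : ∀ i : ℤ, f ((σ ^ i) b) = (σ ^ ψ i) b := by
    intro i
    have h : σ.SameCycle b ((σ ^ i) b) := ⟨i, rfl⟩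
    have h' : ¬ σ.SameCycle a ((σ ^ i) b) := fun h' => hab (h'.trans h.symm)
    simp only [f, dif_neg h', dif_pos h]
    rw [zpow_apply_eq_iff, hψ, ← zpow_apply_eq_iff]
    exact h.choose_spec
  have fz : ∀ z, ¬ σ.SameCycle a z → ¬ σ.SameCycle b z → f z = z := by
    intro z h1 h2
    simp only [f, dif_neg h1, dif_neg h2]
  have cases : ∀ x, (∃ i : ℤ, x = (σ ^ i) a) ∨ (∃ i : ℤ, x = (σ ^ i) b) ∨
      (¬ σ.SameCycle a x ∧ ¬ σ.SameCycle b x) := by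
    intro x
    by_cases h1 : σ.SameCycle a x
    · obtain ⟨i, rfl⟩ := h1
      exact Or.inl ⟨i, rfl⟩
    · by_cases h2 : σ.SameCycle b x
      · obtain ⟨i, rfl⟩ := h2
        exact Or.inr (Or.inl ⟨i, rfl⟩)
      · exact Or.inr (Or.inr ⟨h1, h2⟩)
  have sa : ∀ i : ℤ, σ.SameCycle a ((σ ^ i) a) := fun i => ⟨i, rfl⟩
  have sb : ∀ i : ℤ, σ.SameCycle b ((σ ^ i) b) := fun i => ⟨i, rfl⟩
  have hinj : Injective f := by
    intro x y hxy
    rcases cases x with ⟨i, rfl⟩ | ⟨i, rfl⟩ | ⟨hx1, hx2⟩ <;>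
      rcases cases y with ⟨j, rfl⟩ | ⟨j, rfl⟩ | ⟨hy1, hy2⟩
    · rw [fa, fa, zpow_apply_eq_iff, hφ, ← zpow_apply_eq_iff] at hxy
      exact hxy
    · rw [fa, fb] at hxy
      exact absurd ((sa _).trans (hxy ▸ (sb _).symm)) hab
    · rw [fa, fz y hy1 hy2] at hxy
      exact absurd (hxy ▸ sa _) hy1
    · rw [fa, fb] at hxy
      exact absurd ((sa _).trans (hxy ▸ (sb _).symm)) hab
    · rw [fb, fb, zpow_apply_eq_iff, hψ, ← zpow_apply_eq_iff] at hxy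
      exact hxy
    · rw [fb, fz y hy1 hy2] at hxy
      exact absurd (hxy ▸ sb _) hy2
    · rw [fa, fz x hx1 hx2] at hxy
      exact absurd (hxy ▸ sa _) hx1
    · rw [fb, fz x hx1 hx2] at hxy
      exact absurd (hxy ▸ sb _) hx2
    · rwa [fz x hx1 hx2, fz y hy1 hy2] at hxy
  have hmono : Monotone f := by
    intro x y hxy
    rcases cases x with ⟨i, rfl⟩ | ⟨i, rfl⟩ | ⟨hx1, hx2⟩ <;>
      rcases cases y with ⟨j, rfl⟩ | ⟨j, rfl⟩ | ⟨hy1, hy2⟩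
    · rw [hσ.eq_of_le_of_sameCycle hxy ((sa _).symm.trans (sa _))]
    · rw [fa, fb]
      exact hle _ _ hxy
    · rw [fa, fz y hy1 hy2]
      exact (ha _ _ hy1 hy2).1 hxy
    · exact (hnle _ _ hxy).elim
    · rw [hσ.eq_of_le_of_sameCycle hxy ((sb _).symm.trans (sb _))]
    · rw [fb, fz y hy1 hy2]
      exact (hb _ _ hy1 hy2).1 hxy
    · rw [fa, fz x hx1 hx2]
      exact (ha _ _ hx1 hx2).2 hxy
    · rw [fb, fz x hx1 hx2]
      exact (hb _ _ hx1 hx2).2 hxy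
    · rwa [fz x hx1 hx2, fz y hy1 hy2]
  have := hσ.comm f hinj hmono ((σ ^ i) a)
  rw [← Perm.mul_apply, ← zpow_one_add, add_comm 1 i, fa, fa, ← Perm.mul_apply, ← zpow_one_add,
    add_comm 1, zpow_apply_eq_iff] at this
  exact this

/-- Two points of one cycle cannot be interchanged unless the cycle has length at most two. -/
theorem IsCentralAut.exists_sameCycle_or [Finite P] (hσ : IsCentralAut σ) {a : P}
    {d : ℕ} (hd : ¬ minimalPeriod σ a ∣ d) (h2 : 2 < minimalPeriod σ a) :
    ∃ z, ¬ σ.SameCycle a z ∧ ¬ Nat.gcd (minimalPeriod σ a) (minimalPeriod σ z) ∣ d := by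
  classical
  by_contra! hcon
  have hca : (σ ^ (d : ℤ)) a ≠ a := by
    intro h
    have := (zpow_apply_eq_iff σ a d 0).1 (by simpa using h)
    rw [sub_zero] at this
    exact hd (by exact_mod_cast this)
  have sab : σ.SameCycle a ((σ ^ (d : ℤ)) a) := ⟨d, rfl⟩
  have up : ∀ z, ¬ σ.SameCycle a z →
      (a ≤ z ↔ (σ ^ (d : ℤ)) a ≤ z) := by
    intro z hz
    have hg := hcon z hz
    have h := hσ.le_shift_iff (x := a) (y := z) (i := 0) (j := 0) (i' := d) (j' := 0) (by
      simpa using (Int.natCast_dvd_natCast.2 hg))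
    simpa using h
  have down : ∀ z, ¬ σ.SameCycle a z →
      (z ≤ a ↔ z ≤ (σ ^ (d : ℤ)) a) := by
    intro z hz
    have hg := hcon z hz
    rw [Nat.gcd_comm] at hg
    have h := hσ.le_shift_iff (x := z) (y := a) (i := 0) (j := 0) (i' := 0) (j' := d) (by
      simpa using (Int.natCast_dvd_natCast.2 hg))
    simpa using h
  set b := (σ ^ (d : ℤ)) a with hb
  have hmono : Monotone (Equiv.swap a b) := by
    intro x y hxy
    by_cases hx : σ.SameCycle a x
    · by_cases hy : σ.SameCycle a y
      · rw [hσ.eq_of_le_of_sameCycle hxy (hx.symm.trans hy)]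
      · have hy' : Equiv.swap a b y = y :=
          Equiv.swap_apply_of_ne_of_ne (fun h => hy (h ▸ SameCycle.refl _ _))
            (fun h => hy (h ▸ sab))
        rw [hy']
        by_cases h1 : x = a
        · subst h1
          rw [Equiv.swap_apply_left]
          exact (up y hy).1 hxy
        · by_cases h2 : x = b
          · rw [h2, Equiv.swap_apply_right]
            exact (up y hy).2 (h2 ▸ hxy)
          · rwa [Equiv.swap_apply_of_ne_of_ne h1 h2]
    · have hx' : Equiv.swap a b x = x :=
        Equiv.swap_apply_of_ne_of_ne (fun h => hx (h ▸ SameCycle.refl _ _))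
          (fun h => hx (h ▸ sab))
      rw [hx']
      by_cases h1 : y = a
      · subst h1
        rw [Equiv.swap_apply_left]
        exact (down x hx).1 hxy
      · by_cases h2 : y = b
        · rw [h2, Equiv.swap_apply_right]
          exact (down x hx).2 (h2 ▸ hxy)
        · rwa [Equiv.swap_apply_of_ne_of_ne h1 h2]
  have hcomm := hσ.comm _ (Equiv.swap a b).injective hmono
  have hne1 : σ a ≠ a := by
    intro h
    have := minimalPeriod_eq_one_iff_isFixedPt.2 (h : IsFixedPt σ a)
    omega
  have h1 := hcomm a
  rw [Equiv.swap_apply_left] at h1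
  -- Commuting at `a` says that the swap sends `σ a` to `σ b`. If `σ a = b` this gives `σ ^ 2 a =
  -- a`, against the length; otherwise `σ a = σ b`.
  by_cases h3 : σ a = b
  · rw [h3, Equiv.swap_apply_right, ← h3] at h1
    have : (minimalPeriod σ a : ℤ) ∣ 0 - 2 :=
      (zpow_apply_eq_iff σ a 0 2).1 (by simpa [zpow_ofNat, pow_two] using h1)
    have : (minimalPeriod σ a : ℤ) ∣ 2 := by simpa using this
    have := Nat.le_of_dvd two_pos (by exact_mod_cast this)
    omega
  · rw [Equiv.swap_apply_of_ne_of_ne hne1 h3] at h1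
    exact hca (σ.injective h1).symm

end Central

/-! ### Affine symmetries of subsets of small cyclic groups -/

theorem exists_affine_of_bool {q : ℕ} [NeZero q]
    (h : ∀ S : ZMod q → Bool, ∃ u s : ZMod q, u ≠ 0 ∧ u ≠ 1 ∧ ∀ k, S k = true → S (u * k + s) = true)
    (S : ZMod q → Prop) : ∃ u s : ZMod q, u ≠ 0 ∧ u ≠ 1 ∧ ∀ k, S k → S (u * k + s) := by
  classical
  simpa using h (fun k => decide (S k))

theorem exists_affine_three (S : ZMod 3 → Prop) :
    ∃ u s : ZMod 3, u ≠ 0 ∧ u ≠ 1 ∧ ∀ k, S k → S (u * k + s) :=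
  exists_affine_of_bool (by decide +kernel) S

theorem exists_affine_five (S : ZMod 5 → Prop) :
    ∃ u s : ZMod 5, u ≠ 0 ∧ u ≠ 1 ∧ ∀ k, S k → S (u * k + s) :=
  exists_affine_of_bool (by decide +kernel) S

theorem exists_affine_seven (S : ZMod 7 → Prop) :
    ∃ u s : ZMod 7, u ≠ 0 ∧ u ≠ 1 ∧ ∀ k, S k → S (u * k + s) :=
  exists_affine_of_bool (by decide +kernel) S

/-- A reflection `k ↦ s - k` with `s` even keeps parity. The subsets without one contain exactly one
element of each pair `k`, `k + 2`, and still have a reflection. -/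
theorem reflection_or_four (S : ZMod 4 → Prop) :
    (∃ s : ZMod 4, (s = 0 ∨ s = 2) ∧ ∀ k, S k → S (s - k)) ∨
    ((∃ s : ZMod 4, ∀ k, S k → S (s - k)) ∧ (∀ k, S k ∨ S (k + 2)) ∧
      ∀ k, ¬ (S k ∧ S (k + 2))) := by
  classical
  have h : ∀ S : ZMod 4 → Bool,
      (∃ s : ZMod 4, (s = 0 ∨ s = 2) ∧ ∀ k, S k = true → S (s - k) = true) ∨
      ((∃ s : ZMod 4, ∀ k, S k = true → S (s - k) = true) ∧
        (∀ k, S k = true ∨ S (k + 2) = true) ∧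
        ∀ k, ¬ (S k = true ∧ S (k + 2) = true)) := by decide +kernel
  simpa only [decide_eq_true_eq] using h (fun k => decide (S k))

/-! ### Pairs of cycles: affine maps and reflections -/

section Central

variable {P : Type*} [PartialOrder P] {σ : Perm P}

theorem IsCentralAut.le_iff_zmod (hσ : IsCentralAut σ) {a b : P} {q : ℕ} [NeZero q]
    (hgcd : Nat.gcd (minimalPeriod σ a) (minimalPeriod σ b) = q) (i j : ℤ) :
    (σ ^ i) a ≤ (σ ^ j) b ↔ a ≤ (σ ^ (((j - i : ℤ) : ZMod q).val : ℤ)) b := by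
  have h := hσ.le_shift_iff (x := a) (y := b) (i := i) (j := j) (i' := 0)
    (j' := (((j - i : ℤ) : ZMod q).val : ℤ)) (by
      rw [hgcd, ← ZMod.intCast_zmod_eq_zero_iff_dvd]
      simp)
  simpa using h

/-- Let `S` be the set of residues `k` with `a ≤ σ ^ k b`, and `k ↦ u k + s` an affine map
preserving it. Multiply exponents by `u` modulo `q` on the cycle of `a`, apply `j ↦ u j + s` modulo
`q` on that of `b`, and change nothing modulo `m` and `m'`. The other points see only exponents
modulo `m` and `m'`, so order is preserved; commuting with `σ` would force `u = 1`. -/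
theorem IsCentralAut.false_of_affine [Finite P] (hσ : IsCentralAut σ) {a b : P}
    (hab : ¬ σ.SameCycle a b) (hnle : ∀ i j : ℤ, ¬ (σ ^ j) b ≤ (σ ^ i) a)
    {q m m' : ℕ} (hq : q.Prime) (hqm : ¬ q ∣ m) (hqm' : ¬ q ∣ m')
    (ha : minimalPeriod σ a = q * m) (hb : minimalPeriod σ b = q * m')
    (hgcd : Nat.gcd (minimalPeriod σ a) (minimalPeriod σ b) = q)
    (hza : ∀ z, ¬ σ.SameCycle a z → ¬ σ.SameCycle b z →
      Nat.gcd (minimalPeriod σ a) (minimalPeriod σ z) ∣ m)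
    (hzb : ∀ z, ¬ σ.SameCycle a z → ¬ σ.SameCycle b z →
      Nat.gcd (minimalPeriod σ b) (minimalPeriod σ z) ∣ m')
    (hS : ∀ S : ZMod q → Prop, ∃ u s : ZMod q, u ≠ 0 ∧ u ≠ 1 ∧ ∀ k, S k → S (u * k + s)) :
    False := by
  have : NeZero q := ⟨hq.ne_zero⟩
  obtain ⟨u', s', hu0', hu1', hus⟩ := hS (fun k => a ≤ (σ ^ (k.val : ℤ)) b)
  obtain ⟨u, rfl⟩ := ZMod.intCast_surjective u'
  obtain ⟨s, rfl⟩ := ZMod.intCast_surjective s'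
  have hu0 : ¬ (q : ℤ) ∣ u := fun h => hu0' ((ZMod.intCast_zmod_eq_zero_iff_dvd _ _).2 h)
  have hu1 : ¬ (q : ℤ) ∣ u - 1 := fun h => hu1' (by
    have := (ZMod.intCast_zmod_eq_zero_iff_dvd _ _).2 h
    push_cast at this
    exact sub_eq_zero.1 this)
  have hqp : Prime (q : ℤ) := Nat.prime_iff_prime_int.1 hq
  have hcop : IsCoprime (q : ℤ) ((m * m' : ℕ) : ℤ) := by
    rw [Nat.isCoprime_iff_coprime]
    exact Nat.Coprime.mul_right ((Nat.Prime.coprime_iff_not_dvd hq).2 hqm)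
      ((Nat.Prime.coprime_iff_not_dvd hq).2 hqm')
  obtain ⟨v, w, hvw⟩ := hcop
  push_cast at hvw
  -- The Chinese remainder idempotent: `1` modulo `q` and `0` modulo `m * m'`.
  set e : ℤ := w * (m * m') with he
  have hunit : IsCoprime (1 + e * (u - 1)) (q : ℤ) := by
    have h1 : IsCoprime u (q : ℤ) := ((Prime.coprime_iff_not_dvd hqp).2 hu0).symm
    have h2 : 1 + e * (u - 1) = u + (q : ℤ) * (-(v * (u - 1))) := by
      linear_combination (u - 1) * hvw
    rw [h2]
    exact h1.add_mul_left_left _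
  have hunitm : IsCoprime (1 + e * (u - 1)) (m : ℤ) :=
    ⟨1, -(w * m' * (u - 1)), by rw [he]; ring⟩
  have hunitm' : IsCoprime (1 + e * (u - 1)) (m' : ℤ) :=
    ⟨1, -(w * m * (u - 1)), by rw [he]; ring⟩
  have := hσ.map_add_one hab (fun i => i + e * ((u - 1) * i))
    (fun j => j + e * ((u - 1) * j + s))
    (fun i j => by
      have : i + e * ((u - 1) * i) - (j + e * ((u - 1) * j)) = (1 + e * (u - 1)) * (i - j) := by
        ring
      rw [this, ha]
      push_cast
      exact ⟨(hunit.mul_right hunitm).symm.dvd_of_dvd_mul_left, fun h => h.mul_left _⟩)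
    (fun i j => by
      have : i + e * ((u - 1) * i + s) - (j + e * ((u - 1) * j + s)) =
          (1 + e * (u - 1)) * (i - j) := by
        ring
      rw [this, hb]
      push_cast
      exact ⟨(hunit.mul_right hunitm').symm.dvd_of_dvd_mul_left, fun h => h.mul_left _⟩)
    (fun z i h1 h2 => by
      have h3 : (Nat.gcd (minimalPeriod σ a) (minimalPeriod σ z) : ℤ) ∣ e :=
        (Int.natCast_dvd_natCast.2 (hza z h1 h2)).trans ⟨w * m', by rw [he]; ring⟩
      constructor
      · intro h
        simpa using (hσ.le_shift_iff (x := a) (y := z) (i := i) (j := 0)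
          (i' := i + e * ((u - 1) * i)) (j' := 0)
          (h3.trans ⟨-((u - 1) * i), by ring⟩)).1 (by simpa using h)
      · intro h
        rw [Nat.gcd_comm] at h3
        simpa using (hσ.le_shift_iff (x := z) (y := a) (i := 0) (j := i)
          (i' := 0) (j' := i + e * ((u - 1) * i))
          (h3.trans ⟨((u - 1) * i), by ring⟩)).1 (by simpa using h))
    (fun z i h1 h2 => by
      have h3 : (Nat.gcd (minimalPeriod σ b) (minimalPeriod σ z) : ℤ) ∣ e :=
        (Int.natCast_dvd_natCast.2 (hzb z h1 h2)).trans ⟨w * m, by rw [he]; ring⟩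
      constructor
      · intro h
        simpa using (hσ.le_shift_iff (x := b) (y := z) (i := i) (j := 0)
          (i' := i + e * ((u - 1) * i + s)) (j' := 0)
          (h3.trans ⟨-((u - 1) * i + s), by ring⟩)).1 (by simpa using h)
      · intro h
        rw [Nat.gcd_comm] at h3
        simpa using (hσ.le_shift_iff (x := z) (y := b) (i := 0) (j := i)
          (i' := 0) (j' := i + e * ((u - 1) * i + s))
          (h3.trans ⟨((u - 1) * i + s), by ring⟩)).1 (by simpa using h))
    (fun i j h => by
      rw [hσ.le_iff_zmod hgcd] at h ⊢
      have h4 := hus _ h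
      have h5 : ((j + e * ((u - 1) * j + s) - (i + e * ((u - 1) * i)) : ℤ) : ZMod q) =
          (u : ZMod q) * ((j - i : ℤ) : ZMod q) + s := by
        rw [← Int.cast_mul, ← Int.cast_add, ← sub_eq_zero, ← Int.cast_sub,
          ZMod.intCast_zmod_eq_zero_iff_dvd]
        exact ⟨-(v * ((u - 1) * (j - i) + s)), by linear_combination ((u - 1) * (j - i) + s) * hvw⟩
      rw [h5]
      exact h4)
    hnle 0
  rw [ha] at this
  have h6 : (q : ℤ) ∣ e * (u - 1) := by
    refine (Dvd.intro (m : ℤ) (by push_cast; rfl)).trans (this.trans (dvd_of_eq (by ring)))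
  have h7 : (q : ℤ) ∣ u - 1 := by
    have : u - 1 = e * (u - 1) + q * (v * (u - 1)) := by linear_combination -(u - 1) * hvw
    rw [this]
    exact dvd_add h6 (dvd_mul_right _ _)
  exact hu1 h7

/-- Two cycles are comparable in at most one direction. -/
theorem IsCentralAut.not_le_or_not_le [Finite P] (hσ : IsCentralAut σ) {a b : P}
    (hab : ¬ σ.SameCycle a b) :
    (∀ i j : ℤ, ¬ (σ ^ j) b ≤ (σ ^ i) a) ∨ (∀ i j : ℤ, ¬ (σ ^ j) a ≤ (σ ^ i) b) := by
  by_contra! h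
  obtain ⟨⟨i, j, h1⟩, ⟨k, l, h2⟩⟩ := h
  have h3 : (σ ^ (l + (j - k))) a ≤ (σ ^ j) b := by
    have := (hσ.le_iff (j - k) _ _).2 h2
    rw [← Perm.mul_apply, ← Perm.mul_apply, ← zpow_add, ← zpow_add] at this
    convert this using 3 <;> ring
  have h4 := hσ.eq_of_le_of_sameCycle (h3.trans h1) ⟨i - (l + (j - k)), by
    rw [← Perm.mul_apply, ← zpow_add, sub_add_cancel]⟩
  rw [← h4] at h1
  have h5 := le_antisymm h1 h3
  have sa : σ.SameCycle a ((σ ^ (l + (j - k))) a) := ⟨_, rfl⟩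
  have sb : σ.SameCycle b ((σ ^ j) b) := ⟨_, rfl⟩
  exact hab (sa.trans (h5 ▸ sb.symm))

/-- The direction of comparability is removed by symmetry, and the gcd conditions follow from `q`
not dividing the other periods. -/
theorem IsCentralAut.false_of_affine' [Finite P] (hσ : IsCentralAut σ) {a b : P}
    (hab : ¬ σ.SameCycle a b)
    {q m m' : ℕ} (hq : q.Prime) (hqm : ¬ q ∣ m) (hqm' : ¬ q ∣ m')
    (ha : minimalPeriod σ a = q * m) (hb : minimalPeriod σ b = q * m')
    (hgcd : Nat.gcd (minimalPeriod σ a) (minimalPeriod σ b) = q)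
    (hz : ∀ z, ¬ σ.SameCycle a z → ¬ σ.SameCycle b z → ¬ q ∣ minimalPeriod σ z)
    (hS : ∀ S : ZMod q → Prop, ∃ u s : ZMod q, u ≠ 0 ∧ u ≠ 1 ∧ ∀ k, S k → S (u * k + s)) :
    False := by
  have key : ∀ m l : ℕ, ¬ q ∣ l → Nat.gcd (q * m) l ∣ m := by
    intro m l hl
    refine Nat.Coprime.dvd_of_dvd_mul_left (m := q) ?_
      (Nat.gcd_dvd_left _ _)
    exact ((Nat.Prime.coprime_iff_not_dvd hq).2 fun h => hl (h.trans (Nat.gcd_dvd_right _ _))).symm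
  rcases hσ.not_le_or_not_le hab with h | h
  · exact hσ.false_of_affine hab h hq hqm hqm' ha hb hgcd
      (fun z h1 h2 => ha ▸ key m _ (hz z h1 h2)) (fun z h1 h2 => hb ▸ key m' _ (hz z h1 h2)) hS
  · exact hσ.false_of_affine (fun h => hab h.symm) h hq hqm' hqm hb ha (Nat.gcd_comm _ _ ▸ hgcd)
      (fun z h1 h2 => hb ▸ key m' _ (hz z h2 h1)) (fun z h1 h2 => ha ▸ key m _ (hz z h2 h1)) hS

/-- The point `z` does not distinguish the points of the cycle of `a`. -/
def Indiscernible (σ : Perm P) (a z : P) : Prop :=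
  ∀ i j : ℤ, ((σ ^ i) a ≤ z → (σ ^ j) a ≤ z) ∧ (z ≤ (σ ^ i) a → z ≤ (σ ^ j) a)

theorem IsCentralAut.two_dvd_of_not_indiscernible (hσ : IsCentralAut σ) {a z : P}
    (ha : minimalPeriod σ a = 4) (h : ¬ Indiscernible σ a z) : 2 ∣ minimalPeriod σ z := by
  by_contra h2
  have hg : Nat.gcd (minimalPeriod σ a) (minimalPeriod σ z) = 1 := by
    rw [ha]
    exact Nat.Coprime.pow_left 2 ((Nat.Prime.coprime_iff_not_dvd Nat.prime_two).2 h2)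
  refine h fun i j => ⟨fun h => ?_, fun h => ?_⟩
  · simpa using (hσ.le_shift_iff (x := a) (y := z) (i := i) (j := 0) (i' := j) (j' := 0)
      (by simp [hg])).1 (by simpa using h)
  · simpa using (hσ.le_shift_iff (x := z) (y := a) (i := 0) (j := i) (i' := 0) (j' := j)
      (by simp [Nat.gcd_comm, hg])).1 (by simpa using h)

theorem IsCentralAut.le_shift_even (hσ : IsCentralAut σ) {a z : P}
    (ha : minimalPeriod σ a = 4) (hz : ¬ 4 ∣ minimalPeriod σ z) {i j : ℤ} (hij : 2 ∣ i - j) :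
    ((σ ^ i) a ≤ z → (σ ^ j) a ≤ z) ∧ (z ≤ (σ ^ i) a → z ≤ (σ ^ j) a) := by
  have hg : Nat.gcd (minimalPeriod σ a) (minimalPeriod σ z) ∣ 2 := by
    have h1 : Nat.gcd (minimalPeriod σ a) (minimalPeriod σ z) ∣ 2 ^ 2 := by
      have := Nat.gcd_dvd_left (minimalPeriod σ a) (minimalPeriod σ z)
      rwa [ha] at this ⊢
    obtain ⟨k, hk, hk'⟩ := (Nat.dvd_prime_pow Nat.prime_two).1 h1
    rcases Nat.lt_or_ge k 2 with h | h
    · rw [hk']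
      exact pow_dvd_pow 2 (by omega : k ≤ 1)
    · obtain rfl : k = 2 := by omega
      have := Nat.gcd_dvd_right (minimalPeriod σ a) (minimalPeriod σ z)
      rw [hk'] at this
      exact absurd this hz
  have hg' : (Nat.gcd (minimalPeriod σ a) (minimalPeriod σ z) : ℤ) ∣ 2 := by exact_mod_cast hg
  constructor
  · intro h
    simpa using (hσ.le_shift_iff (x := a) (y := z) (i := i) (j := 0) (i' := j) (j' := 0)
      (by simpa using hg'.trans hij)).1 (by simpa using h)
  · intro h
    rw [Nat.gcd_comm] at hg'
    simpa using (hσ.le_shift_iff (x := z) (y := a) (i := 0) (j := i) (i' := 0) (j' := j)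
      (by
        have := dvd_neg.2 (hg'.trans hij)
        rwa [neg_sub, ← sub_sub_sub_cancel_left i j 0] at this)).1 (by simpa using h)

/-- The maps `i ↦ s - i` and `j ↦ t - j` send the difference `j - i` to `(t - s) - (j - i)`. An
outside point sees at most the parity of an exponent, which an even `s` or `t` preserves; an odd one
is harmless only if outside points see nothing. -/
theorem IsCentralAut.false_of_reflection [Finite P] (hσ : IsCentralAut σ) {a b : P}
    (hab : ¬ σ.SameCycle a b) (hnle : ∀ i j : ℤ, ¬ (σ ^ j) b ≤ (σ ^ i) a)
    (ha : minimalPeriod σ a = 4) (hb : minimalPeriod σ b = 4)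
    (hz : ∀ z, ¬ σ.SameCycle a z → ¬ σ.SameCycle b z → ¬ 4 ∣ minimalPeriod σ z)
    (s t : ℤ)
    (hs : 2 ∣ s ∨ ∀ z, ¬ σ.SameCycle a z → ¬ σ.SameCycle b z → Indiscernible σ a z)
    (ht : 2 ∣ t ∨ ∀ z, ¬ σ.SameCycle a z → ¬ σ.SameCycle b z → Indiscernible σ b z)
    (hS : ∀ k : ZMod 4, a ≤ (σ ^ (k.val : ℤ)) b → a ≤ (σ ^ ((((t - s : ℤ) : ZMod 4) - k).val : ℤ)) b) :
    False := by
  have hgcd : Nat.gcd (minimalPeriod σ a) (minimalPeriod σ b) = 4 := by rw [ha, hb]; rfl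
  have := hσ.map_add_one hab (fun i => s - i) (fun j => t - j)
    (fun i j => by rw [sub_sub_sub_cancel_left, dvd_sub_comm])
    (fun i j => by rw [sub_sub_sub_cancel_left, dvd_sub_comm])
    (fun z i h1 h2 => by
      rcases hs with h | h
      · exact hσ.le_shift_even ha (hz z h1 h2) (by omega)
      · exact h z h1 h2 _ _)
    (fun z i h1 h2 => by
      rcases ht with h | h
      · exact hσ.le_shift_even hb (hz z h1 h2) (by omega)
      · exact h z h1 h2 _ _)
    (fun i j h => by
      rw [hσ.le_iff_zmod hgcd] at h ⊢
      have h4 := hS _ h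
      rw [← Int.cast_sub] at h4
      rwa [show t - j - (s - i) = t - s - (j - i) by ring])
    hnle 0
  -- The values `s - 1` and `s + 1` differ by `2`, which is not divisible by `4`.
  rw [ha] at this
  omega

theorem IsCentralAut.exists_of_four_aux [Finite P] (hσ : IsCentralAut σ) {a b : P}
    (hab : ¬ σ.SameCycle a b) (hnle : ∀ i j : ℤ, ¬ (σ ^ j) b ≤ (σ ^ i) a)
    (ha : minimalPeriod σ a = 4) (hb : minimalPeriod σ b = 4)
    (hz : ∀ z, ¬ σ.SameCycle a z → ¬ σ.SameCycle b z → ¬ 4 ∣ minimalPeriod σ z) :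
    ∃ z w, ¬ σ.SameCycle z w ∧ 2 ∣ minimalPeriod σ z ∧ ¬ 4 ∣ minimalPeriod σ z ∧
      2 ∣ minimalPeriod σ w ∧ ¬ 4 ∣ minimalPeriod σ w := by
  have hgcd : Nat.gcd (minimalPeriod σ a) (minimalPeriod σ b) = 4 := by rw [ha, hb]; rfl
  have key := hσ.le_iff_zmod hgcd
  rcases reflection_or_four (fun k => a ≤ (σ ^ (k.val : ℤ)) b) with
    ⟨s, hs, hS⟩ | ⟨⟨s, hS⟩, hS1, hS2⟩
  · refine (hσ.false_of_reflection hab hnle ha hb hz 0 s.val (Or.inl (by simp)) (Or.inl ?_) ?_).elim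
    · rcases hs with rfl | rfl <;> decide
    · simpa using hS
  -- The odd shift can be put on either cycle, so some `z` must distinguish points of the cycle of
  -- `a`, and some `w` points of that of `b`. It remains to see that these lie in different cycles.
  · by_cases hA : ∀ z, ¬ σ.SameCycle a z → ¬ σ.SameCycle b z → Indiscernible σ a z
    · exact (hσ.false_of_reflection hab hnle ha hb hz (-s.val) 0 (Or.inr hA) (Or.inl (by simp))
        (by simpa using hS)).elim
    by_cases hB : ∀ z, ¬ σ.SameCycle a z → ¬ σ.SameCycle b z → Indiscernible σ b z
    · exact (hσ.false_of_reflection hab hnle ha hb hz 0 s.val (Or.inl (by simp)) (Or.inr hB)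
        (by simpa using hS)).elim
    push Not at hA hB
    obtain ⟨z, hz1, hz2, hzi⟩ := hA
    obtain ⟨w, hw1, hw2, hwi⟩ := hB
    refine ⟨z, w, fun hzw => ?_, hσ.two_dvd_of_not_indiscernible ha hzi, hz z hz1 hz2,
      hσ.two_dvd_of_not_indiscernible hb hwi, hz w hw1 hw2⟩
    obtain ⟨t, rfl⟩ := hzw
    have cover : ∀ i j : ℤ, (σ ^ i) a ≤ (σ ^ j) b ∨ (σ ^ i) a ≤ (σ ^ (j + 2)) b := by
      intro i j
      rw [key, key]
      have := hS1 ((j - i : ℤ) : ZMod 4)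
      rwa [show (((j + 2 - i : ℤ)) : ZMod 4) = ((j - i : ℤ) : ZMod 4) + 2 by push_cast; ring]
    have excl : ∀ i j : ℤ, (σ ^ i) a ≤ (σ ^ j) b → ¬ (σ ^ i) a ≤ (σ ^ (j + 2)) b := by
      intro i j h1 h2
      rw [key] at h1 h2
      rw [show (((j + 2 - i : ℤ)) : ZMod 4) = ((j - i : ℤ) : ZMod 4) + 2 by push_cast; ring] at h2
      exact hS2 _ ⟨h1, h2⟩
    have transl_le : ∀ j : ℤ, (σ ^ t) z ≤ (σ ^ j) b ↔ z ≤ (σ ^ (j - t)) b := by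
      intro j
      rw [← hσ.le_iff t z, ← Perm.mul_apply, ← zpow_add, add_sub_cancel]
    have transl_ge : ∀ j : ℤ, (σ ^ j) b ≤ (σ ^ t) z ↔ (σ ^ (j - t)) b ≤ z := by
      intro j
      rw [← hσ.le_iff t _ z, ← Perm.mul_apply, ← zpow_add, add_sub_cancel]
    have evenA := fun (i : ℤ) => hσ.le_shift_even (z := z) (i := i) (j := i + 2) ha (hz z hz1 hz2)
      (by omega)
    have evenB := fun (i : ℤ) => hσ.le_shift_even (z := z) (i := i) (j := i + 2) hb (hz z hz1 hz2)
      (by omega)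
    -- If `z` is below a point of the cycle of `a`, it is below the whole cycle of `b`, and so is
    -- its translate `w`: nothing is distinguished. The case `c2` is dual. Otherwise `z` separates
    -- some `σ ^ i a` below from both `σ ^ j b` and `σ ^ (j + 2) b` above, against `excl`.
    by_cases c1 : ∃ i : ℤ, z ≤ (σ ^ i) a
    · obtain ⟨i, hi⟩ := c1
      have all : ∀ j : ℤ, z ≤ (σ ^ j) b := by
        intro j
        rcases cover i j with h | h
        · exact hi.trans h
        · have h' : (σ ^ (i + 2)) a ≤ (σ ^ j) b :=
            (hσ.le_shift_iff (by rw [hgcd]; omega)).1 h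
          exact ((evenA i).2 hi).trans h'
      have none : ∀ j : ℤ, ¬ (σ ^ j) b ≤ z := fun j hj =>
        hz2 ⟨j, le_antisymm hj (all j)⟩
      exact hwi fun i j => ⟨fun h => absurd ((transl_ge i).1 h) (none _),
        fun _ => (transl_le j).2 (all _)⟩
    by_cases c2 : ∃ j : ℤ, (σ ^ j) b ≤ z
    · obtain ⟨j, hj⟩ := c2
      have all : ∀ i : ℤ, (σ ^ i) a ≤ z := by
        intro i
        rcases cover i j with h | h
        · exact h.trans hj
        · exact h.trans ((evenB j).1 hj)
      exact hzi fun i j => ⟨fun _ => all j, fun h => absurd ⟨i, h⟩ c1⟩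
    have h1 : ∃ i : ℤ, (σ ^ i) a ≤ z := by
      by_contra hcon
      exact hzi fun i j => ⟨fun h => absurd ⟨i, h⟩ hcon, fun h => absurd ⟨i, h⟩ c1⟩
    have h2 : ∃ j : ℤ, z ≤ (σ ^ j) b := by
      by_contra hcon
      exact hwi fun i j => ⟨fun h => absurd ⟨_, (transl_ge i).1 h⟩ c2,
        fun h => absurd ⟨_, (transl_le i).1 h⟩ hcon⟩
    obtain ⟨i, hi⟩ := h1
    obtain ⟨j, hj⟩ := h2
    exact excl i j (hi.trans hj) (hi.trans ((evenB j).2 hj))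

theorem IsCentralAut.exists_of_four [Finite P] (hσ : IsCentralAut σ) {a b : P}
    (hab : ¬ σ.SameCycle a b)
    (ha : minimalPeriod σ a = 4) (hb : minimalPeriod σ b = 4)
    (hz : ∀ z, ¬ σ.SameCycle a z → ¬ σ.SameCycle b z → ¬ 4 ∣ minimalPeriod σ z) :
    ∃ z w, ¬ σ.SameCycle z w ∧ 2 ∣ minimalPeriod σ z ∧ ¬ 4 ∣ minimalPeriod σ z ∧
      2 ∣ minimalPeriod σ w ∧ ¬ 4 ∣ minimalPeriod σ w := by
  rcases hσ.not_le_or_not_le hab with h | h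
  · exact hσ.exists_of_four_aux hab h ha hb hz
  · exact hσ.exists_of_four_aux (fun h => hab h.symm) h hb ha fun z h1 h2 => hz z h2 h1

end Central

/-! ### From order relations to the existence of further cycles -/

theorem prime_pow_dvd_lcm {p r a b : ℕ} (hp : p.Prime) (h : p ^ r ∣ Nat.lcm a b) :
    p ^ r ∣ a ∨ p ^ r ∣ b := by
  rcases Nat.eq_zero_or_pos a with rfl | ha
  · simp
  rcases Nat.eq_zero_or_pos b with rfl | hb
  · simp
  rw [hp.pow_dvd_iff_le_factorization (Nat.lcm_ne_zero ha.ne' hb.ne'),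
    Nat.factorization_lcm ha.ne' hb.ne', Finsupp.sup_apply, le_sup_iff] at h
  rwa [hp.pow_dvd_iff_le_factorization ha.ne', hp.pow_dvd_iff_le_factorization hb.ne']

theorem prime_pow_dvd_multiset_lcm {p r : ℕ} (hp : p.Prime) (hr : r ≠ 0) (s : Multiset ℕ)
    (h : p ^ r ∣ s.lcm) : ∃ a ∈ s, p ^ r ∣ a := by
  induction s using Multiset.induction_on with
  | empty =>
    rw [Multiset.lcm_zero, Nat.dvd_one, Nat.pow_eq_one] at h
    exact absurd (h.resolve_right hr) hp.ne_one
  | cons a s ih =>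
    rw [Multiset.lcm_cons] at h
    rcases prime_pow_dvd_lcm hp h with h | h
    · exact ⟨a, Multiset.mem_cons_self _ _, h⟩
    · obtain ⟨b, hb, hb'⟩ := ih h
      exact ⟨b, Multiset.mem_cons_of_mem hb, hb'⟩

theorem dvd_pow_pred_mul {p r m d : ℕ} (hp : p.Prime) (hr : r ≠ 0) (hd : d ∣ p ^ r * m)
    (hpd : ¬ p ^ r ∣ d) : d ∣ p ^ (r - 1) * m := by
  obtain ⟨u, v, hu, hv, rfl⟩ := (Nat.dvd_mul).1 hd
  obtain ⟨k, hk, rfl⟩ := (Nat.dvd_prime_pow hp).1 hu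
  refine Nat.mul_dvd_mul (pow_dvd_pow p ?_) hv
  rcases Nat.lt_or_ge k r with h | h
  · omega
  · obtain rfl : k = r := by omega
    exact absurd (Nat.dvd_mul_right _ _) hpd

section Cycles

variable {P : Type*} [Fintype P] [DecidableEq P] {σ : Perm P}

theorem exists_mem_cycleFactorsFinset_dvd {p r : ℕ} (hp : p.Prime) (hr : r ≠ 0)
    (h : p ^ r ∣ orderOf σ) : ∃ α ∈ σ.cycleFactorsFinset, p ^ r ∣ α.support.card := by
  rw [← lcm_cycleType] at h
  obtain ⟨a, ha, hdvd⟩ := prime_pow_dvd_multiset_lcm hp hr _ h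
  rw [cycleType_def, Multiset.mem_map] at ha
  obtain ⟨α, hα, rfl⟩ := ha
  exact ⟨α, hα, hdvd⟩

theorem card_support_dvd_orderOf {α : Perm P} (hα : α ∈ σ.cycleFactorsFinset) :
    α.support.card ∣ orderOf σ := by
  rw [← lcm_cycleType, cycleType_def]
  exact Multiset.dvd_lcm (Multiset.mem_map.2 ⟨α, hα, rfl⟩)

theorem exists_mem_support_of_mem_cycleFactorsFinset {α : Perm P}
    (hα : α ∈ σ.cycleFactorsFinset) :
    ∃ a, minimalPeriod σ a = α.support.card ∧ σ.cycleOf a = α := by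
  obtain ⟨a, ha⟩ := (mem_cycleFactorsFinset_iff.1 hα).1.nonempty_support
  exact ⟨a, minimalPeriod_eq_card_support σ hα ha, (cycle_is_cycleOf ha hα).symm⟩

theorem cycleOf_mem_of_minimalPeriod_ne_one {z : P} (hz : minimalPeriod σ z ≠ 1) :
    σ.cycleOf z ∈ σ.cycleFactorsFinset ∧ (σ.cycleOf z).support.card = minimalPeriod σ z := by
  have h1 : σ z ≠ z := fun h => hz (minimalPeriod_eq_one_iff_isFixedPt.2 h)
  have h2 : σ.cycleOf z ∈ σ.cycleFactorsFinset :=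
    cycleOf_mem_cycleFactorsFinset_iff.2 (mem_support.2 h1)
  refine ⟨h2, (minimalPeriod_eq_card_support σ h2 ?_).symm⟩
  rw [mem_support_cycleOf_iff]
  exact ⟨SameCycle.refl _ _, mem_support.2 h1⟩

theorem sameCycle_of_cycleOf_eq {x y : P} (hy : minimalPeriod σ y ≠ 1)
    (h : σ.cycleOf x = σ.cycleOf y) : σ.SameCycle x y := by
  have h1 : σ y ≠ y := fun h => hy (minimalPeriod_eq_one_iff_isFixedPt.2 h)
  have h2 : y ∈ (σ.cycleOf y).support := by
    rw [mem_support_cycleOf_iff]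
    exact ⟨SameCycle.refl _ _, mem_support.2 h1⟩
  rw [← h, mem_support_cycleOf_iff] at h2
  exact h2.1

theorem exists_cycle_ne [PartialOrder P] (hσ : IsCentralAut σ) {p r : ℕ} (hp : p.Prime)
    (hr : r ≠ 0) {α : Perm P} (hα : α ∈ σ.cycleFactorsFinset) (hdvd : p ^ r ∣ α.support.card)
    (hndvd : ¬ p ^ (r + 1) ∣ α.support.card) (h2 : 2 < α.support.card) :
    ∃ β ∈ σ.cycleFactorsFinset, β ≠ α ∧ p ^ r ∣ β.support.card := by
  obtain ⟨a, ha, rfl⟩ := exists_mem_support_of_mem_cycleFactorsFinset hα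
  rw [← ha] at hdvd hndvd h2
  obtain ⟨m, hm⟩ := hdvd
  obtain ⟨r, rfl⟩ := Nat.exists_eq_succ_of_ne_zero hr
  have hm0 : 0 < p ^ r * m := by
    rcases Nat.eq_zero_or_pos (p ^ r * m) with h | h
    · rw [hm, pow_succ, mul_right_comm, h] at h2
      omega
    · exact h
  -- The distance of the two swapped points is the cycle length divided by `p`.
  have hd : ¬ minimalPeriod σ a ∣ p ^ r * m := by
    intro h
    have h3 := Nat.le_of_dvd hm0 h
    have h4 : minimalPeriod σ a = p * (p ^ r * m) := by rw [hm, pow_succ]; ring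
    have h5 := Nat.mul_le_mul_right (p ^ r * m) hp.two_le
    omega
  obtain ⟨z, hz, hgz⟩ := hσ.exists_sameCycle_or hd h2
  have hpz : p ^ (r + 1) ∣ minimalPeriod σ z := by
    by_contra hcon
    refine hgz (dvd_pow_pred_mul hp hr (hm ▸ Nat.gcd_dvd_left _ _) fun h => hcon ?_)
    exact h.trans (Nat.gcd_dvd_right _ _)
  have hz1 : minimalPeriod σ z ≠ 1 := by
    intro h
    rw [h, Nat.gcd_one_right] at hgz
    exact hgz (one_dvd _)
  obtain ⟨h6, h7⟩ := cycleOf_mem_of_minimalPeriod_ne_one hz1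
  exact ⟨_, h6, fun h => hz (sameCycle_of_cycleOf_eq hz1 h.symm), h7.symm ▸ hpz⟩

theorem exists_third_cycle [PartialOrder P] (hσ : IsCentralAut σ) {q : ℕ}
    (hq : q = 3 ∨ q = 5 ∨ q = 7) {α β : Perm P} (hα : α ∈ σ.cycleFactorsFinset)
    (hβ : β ∈ σ.cycleFactorsFinset) (hαβ : α ≠ β)
    (hqα : ¬ q ^ 2 ∣ α.support.card) (hqβ : ¬ q ^ 2 ∣ β.support.card)
    (hgcd : Nat.gcd α.support.card β.support.card = q) :
    ∃ γ ∈ σ.cycleFactorsFinset, γ ≠ α ∧ γ ≠ β ∧ q ∣ γ.support.card := by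
  have hp : q.Prime := by rcases hq with rfl | rfl | rfl <;> norm_num
  have hS : ∀ S : ZMod q → Prop, ∃ u s : ZMod q, u ≠ 0 ∧ u ≠ 1 ∧ ∀ k, S k → S (u * k + s) := by
    rcases hq with rfl | rfl | rfl
    · exact exists_affine_three
    · exact exists_affine_five
    · exact exists_affine_seven
  obtain ⟨a, ha, rfl⟩ := exists_mem_support_of_mem_cycleFactorsFinset hα
  obtain ⟨b, hb, rfl⟩ := exists_mem_support_of_mem_cycleFactorsFinset hβ
  rw [← ha] at hqα hgcd
  rw [← hb] at hqβ hgcd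
  obtain ⟨m, hm⟩ : q ∣ minimalPeriod σ a := hgcd ▸ Nat.gcd_dvd_left _ _
  obtain ⟨m', hm'⟩ : q ∣ minimalPeriod σ b := hgcd ▸ Nat.gcd_dvd_right _ _
  have hqm : ∀ l k : ℕ, l = q * k → ¬ q ^ 2 ∣ l → ¬ q ∣ k := by
    rintro l k rfl h1 h2
    exact h1 (pow_two q ▸ Nat.mul_dvd_mul_left q h2)
  by_contra! hcon
  refine hσ.false_of_affine' (fun h => hαβ h.cycleOf_eq) hp (hqm _ _ hm hqα) (hqm _ _ hm' hqβ)
    hm hm' hgcd (fun z h1 h2 h3 => ?_) hS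
  have hz1 : minimalPeriod σ z ≠ 1 := fun h => hp.ne_one (Nat.dvd_one.1 (h ▸ h3))
  obtain ⟨h6, h7⟩ := cycleOf_mem_of_minimalPeriod_ne_one hz1
  exact hcon _ h6 (fun h => h1 (sameCycle_of_cycleOf_eq hz1 h.symm))
    (fun h => h2 (sameCycle_of_cycleOf_eq hz1 h.symm)) (h7.symm ▸ h3)

theorem exists_two_cycles_of_four [PartialOrder P] (hσ : IsCentralAut σ) {α β : Perm P}
    (hα : α ∈ σ.cycleFactorsFinset) (hβ : β ∈ σ.cycleFactorsFinset) (hαβ : α ≠ β)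
    (hα4 : α.support.card = 4) (hβ4 : β.support.card = 4)
    (hγ : ∀ γ ∈ σ.cycleFactorsFinset, γ ≠ α → γ ≠ β → ¬ 4 ∣ γ.support.card) :
    ∃ γ ∈ σ.cycleFactorsFinset, ∃ δ ∈ σ.cycleFactorsFinset, γ ≠ δ ∧
      2 ∣ γ.support.card ∧ ¬ 4 ∣ γ.support.card ∧ 2 ∣ δ.support.card ∧ ¬ 4 ∣ δ.support.card := by
  obtain ⟨a, ha, rfl⟩ := exists_mem_support_of_mem_cycleFactorsFinset hα
  obtain ⟨b, hb, rfl⟩ := exists_mem_support_of_mem_cycleFactorsFinset hβ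
  obtain ⟨z, w, hzw, hz2, hz4, hw2, hw4⟩ := hσ.exists_of_four (fun h => hαβ h.cycleOf_eq)
    (ha.trans hα4) (hb.trans hβ4) (fun z h1 h2 h3 => by
      have hz1 : minimalPeriod σ z ≠ 1 := by omega
      obtain ⟨h6, h7⟩ := cycleOf_mem_of_minimalPeriod_ne_one hz1
      exact hγ _ h6 (fun h => h1 (sameCycle_of_cycleOf_eq hz1 h.symm))
        (fun h => h2 (sameCycle_of_cycleOf_eq hz1 h.symm)) (h7.symm ▸ h3))
  obtain ⟨h1, h1'⟩ := cycleOf_mem_of_minimalPeriod_ne_one (z := z) (σ := σ) (by omega)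
  obtain ⟨h2, h2'⟩ := cycleOf_mem_of_minimalPeriod_ne_one (z := w) (σ := σ) (by omega)
  refine ⟨_, h1, _, h2, fun h => hzw (sameCycle_of_cycleOf_eq (by omega) h), ?_⟩
  rw [h1', h2']
  exact ⟨hz2, hz4, hw2, hw4⟩

end Cycles

/-! ### Exact divisibility and estimates for the general weight -/

theorem exactDvd_prime_pow_iff {p r n : ℕ} (hp : p.Prime) (hr : 1 ≤ r) :
    ExactDvd (p ^ r) n ↔ p ^ r ∣ n ∧ ¬ p ^ (r + 1) ∣ n := by
  constructor
  · rintro ⟨p', r', hp', hr', heq, h1, h2⟩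
    have hpp : p = p' := (Nat.prime_dvd_prime_iff_eq hp hp').1
      (hp.dvd_of_dvd_pow (heq ▸ dvd_pow_self p (by omega)))
    subst hpp
    obtain rfl : r = r' := Nat.pow_right_injective hp.two_le heq
    exact ⟨h1, h2⟩
  · exact fun ⟨h1, h2⟩ => ⟨p, r, hp, hr, rfl, h1, h2⟩

theorem exactDvd_prime_iff {p n : ℕ} (hp : p.Prime) :
    ExactDvd p n ↔ p ∣ n ∧ ¬ p ^ 2 ∣ n := by
  simpa using exactDvd_prime_pow_iff (n := n) hp le_rfl

theorem exactDvd_two_iff {n : ℕ} : ExactDvd 2 n ↔ 2 ∣ n ∧ ¬ 4 ∣ n :=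
  exactDvd_prime_iff Nat.prime_two

theorem exactDvd_three_iff {n : ℕ} : ExactDvd 3 n ↔ 3 ∣ n ∧ ¬ 9 ∣ n :=
  exactDvd_prime_iff Nat.prime_three

theorem exactDvd_four_iff {n : ℕ} : ExactDvd 4 n ↔ 4 ∣ n ∧ ¬ 8 ∣ n :=
  exactDvd_prime_pow_iff (r := 2) Nat.prime_two (by norm_num)

/-- Every prime factor other than `2` is at least `3`; a factor `2` loses only the ratio `2 / 3`. -/
theorem two_mul_three_pow_card_primeFactors_le {m : ℕ} (hm : 1 ≤ m) :
    2 * 3 ^ m.primeFactors.card ≤ 3 * m := by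
  have h1 : ∏ p ∈ m.primeFactors, p ≤ m := Nat.le_of_dvd hm (Nat.prod_primeFactors_dvd m)
  have h2 : 3 ^ (m.primeFactors.erase 2).card ≤ ∏ p ∈ m.primeFactors.erase 2, p := by
    refine Finset.pow_card_le_prod _ _ _ fun p hp => ?_
    have h3 := (Nat.prime_of_mem_primeFactors (Finset.mem_of_mem_erase hp)).two_le
    have h4 := Finset.ne_of_mem_erase hp
    omega
  by_cases h : 2 ∈ m.primeFactors
  · rw [← Finset.mul_prod_erase _ _ h] at h1
    rw [← Finset.card_erase_add_one h, pow_succ]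
    omega
  · rw [Finset.erase_eq_of_notMem h] at h2
    omega

theorem two_mul_card_primeFactors_add_one_le {m : ℕ} (hm : 4 ≤ m) :
    2 * (m.primeFactors.card + 1) ≤ m := by
  have h := two_mul_three_pow_card_primeFactors_le (m := m) (by omega)
  generalize m.primeFactors.card = k at h
  rcases Nat.lt_or_ge k 2 with hk | hk
  · omega
  · have : 3 * (k + 1) ≤ 3 ^ k := by
      induction k, hk using Nat.le_induction with
      | base => norm_num
      | succ k hk ih => rw [pow_succ] at h ⊢; have := ih (by omega); omega
    omega

theorem four_mul_card_primeFactors_add_one_le {m : ℕ} (hm : 20 ≤ m) :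
    4 * (m.primeFactors.card + 1) ≤ m := by
  have h := two_mul_three_pow_card_primeFactors_le (m := m) (by omega)
  generalize m.primeFactors.card = k at h
  rcases Nat.lt_or_ge k 4 with hk | hk
  · omega
  · have : 6 * (k + 1) ≤ 3 ^ k := by
      induction k, hk using Nat.le_induction with
      | base => norm_num
      | succ k hk ih => rw [pow_succ] at h ⊢; have := ih (by omega); omega
    omega

/-- The quotient of `m` by one more than its number of prime factors. -/
noncomputable def share (m : ℕ) : ℝ := (m : ℝ) / ((m.primeFactors.card + 1 : ℕ) : ℝ)

theorem le_share_iff {m : ℕ} {c : ℝ} : c ≤ share m ↔ c * (m.primeFactors.card + 1) ≤ m := by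
  rw [share, le_div_iff₀ (by positivity)]
  push_cast
  rfl

theorem share_three : share 3 = 3 / 2 := by
  rw [share, Nat.Prime.primeFactors Nat.prime_three]
  norm_num

theorem two_le_share {m : ℕ} (hm : 4 ≤ m) : 2 ≤ share m := by
  rw [le_share_iff]
  exact_mod_cast two_mul_card_primeFactors_add_one_le hm

theorem four_le_share {m : ℕ} (hm : 20 ≤ m) : 4 ≤ share m := by
  rw [le_share_iff]
  exact_mod_cast four_mul_card_primeFactors_add_one_le hm

theorem three_halves_le_share {m : ℕ} (hm : 3 ≤ m) : 3 / 2 ≤ share m := by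
  rcases hm.eq_or_lt with rfl | h
  · exact share_three.ge
  · linarith [two_le_share h]

theorem one_le_share {m : ℕ} (hm : 1 ≤ m) : 1 ≤ share m := by
  rcases Nat.lt_or_ge m 3 with h | h
  · interval_cases m
    · simp [share]
    · rw [share, Nat.Prime.primeFactors Nat.prime_two]
      norm_num
  · linarith [three_halves_le_share h]

theorem card_primeFactors_prime_pow_mul {p r m : ℕ} (hp : p.Prime) (hr : 1 ≤ r) (hm : ¬ p ∣ m) :
    (p ^ r * m).primeFactors.card = m.primeFactors.card + 1 := by
  have hc : Nat.Coprime (p ^ r) m := Nat.Coprime.pow_left r ((Nat.Prime.coprime_iff_not_dvd hp).2 hm)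
  rw [hc.primeFactors_mul, Finset.card_union_of_disjoint hc.disjoint_primeFactors,
    Nat.primeFactors_prime_pow (by omega) hp, Finset.card_singleton, add_comm]

theorem generalWeight_nonneg (n l q : ℕ) : 0 ≤ generalWeight n l q := by
  unfold generalWeight
  split_ifs <;> positivity

theorem weight_nonneg (n l q : ℕ) : 0 ≤ weight n l q := by
  unfold weight weightSix weightTwelve weightTwice
  split_ifs <;> first | exact generalWeight_nonneg _ _ _ | norm_num

theorem ExactDvd.isPrimePow {q n : ℕ} (h : ExactDvd q n) : IsPrimePow q := by
  obtain ⟨p, r, hp, hr, rfl, -, -⟩ := h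
  exact hp.isPrimePow.pow (by omega)

theorem ExactDvd.of_dvd {q n l : ℕ} (h : ExactDvd q n) (hql : q ∣ l) (hln : l ∣ n) :
    ExactDvd q l := by
  obtain ⟨p, r, hp, hr, rfl, -, h2⟩ := h
  exact ⟨p, r, hp, hr, rfl, hql, fun h => h2 (h.trans hln)⟩

theorem generalWeight_eq_share {n l q : ℕ} (hq : ExactDvd q n) (hql : q ∣ l) (hln : l ∣ n) :
    ∃ m, l = q * m ∧ generalWeight n l q = share m := by
  have hl := hq.of_dvd hql hln
  have hc1 : ¬ (ExactDvd 2 l ∧ ¬ ExactDvd 2 n ∧ q = 2) := by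
    rintro ⟨-, h, rfl⟩
    exact h hq
  have hc2 : ¬ (ExactDvd 2 l ∧ ¬ ExactDvd 2 n ∧ q = 4) := by
    rintro ⟨h, -, rfl⟩
    exact (exactDvd_two_iff.1 h).2 hql
  rw [generalWeight, if_neg hc1, if_neg hc2, if_pos hl]
  obtain ⟨p, r, hp, hr, rfl, ⟨m, rfl⟩, h2⟩ := hl
  have hm : ¬ p ∣ m := fun h => h2 (pow_succ p r ▸ Nat.mul_dvd_mul_left _ h)
  refine ⟨m, rfl, ?_⟩
  have hp0 : (p : ℝ) ^ r ≠ 0 := pow_ne_zero _ (by exact_mod_cast hp.ne_zero)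
  rw [card_primeFactors_prime_pow_mul hp hr hm, share]
  congr 1
  push_cast
  field_simp

theorem generalWeight_four_eq_share {n l : ℕ} (hn : ¬ ExactDvd 2 n) (h2 : 2 ∣ l) (h4 : ¬ 4 ∣ l) :
    ∃ m, l = 2 * m ∧ generalWeight n l 4 = share m / 2 := by
  have hl : ExactDvd 2 l := exactDvd_two_iff.2 ⟨h2, h4⟩
  obtain ⟨m, rfl⟩ := h2
  refine ⟨m, rfl, ?_⟩
  rw [generalWeight, if_neg (by norm_num), if_pos ⟨hl, hn, rfl⟩]
  have h := card_primeFactors_prime_pow_mul (r := 1) (m := m) Nat.prime_two le_rfl (by omega)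
  rw [pow_one] at h
  rw [h, share]
  push_cast
  field_simp

/-! ### Lower bounds for single weights -/

section Bounds

variable {n l : ℕ}

theorem one_le_weight {q : ℕ} (hq : ExactDvd q n) (hql : q ∣ l) (hln : l ∣ n) (hl : 1 ≤ l)
    (h2 : q ≠ 2) (h4 : q ≠ 4) : 1 ≤ weight n l q := by
  have hpp := hq.isPrimePow
  -- A prime power dividing a coprime product divides one factor; this identifies `q` at each
  -- exceptional length.
  have key : ∀ a p : ℕ, p.Prime → Nat.Coprime a p → l = a * p → ¬ q ∣ a → q = p := by
    intro a p hp hc hl h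
    rw [hl, hc.isPrimePow_dvd_mul hpp] at hql
    exact ((Nat.dvd_prime hp).1 (hql.resolve_left h)).resolve_left hpp.ne_one
  have h1 := hpp.ne_one
  have hd2 : ¬ q ∣ 2 := fun h => by
    rcases (Nat.dvd_prime Nat.prime_two).1 h with h | h <;> contradiction
  have hd4 : ¬ q ∣ 4 := fun h => by
    obtain ⟨k, hk, hk'⟩ := (Nat.dvd_prime_pow Nat.prime_two (m := 2)).1 h
    interval_cases k <;> simp_all
  unfold weight weightSix weightTwelve weightTwice
  split_ifs with c1 c2 c3 c4 c5 c6 c7 <;>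
    try first
      | (have := key 2 3 (by norm_num) (by norm_num) (by omega) hd2; subst this; contradiction)
      | (have := key 4 3 (by norm_num) (by norm_num) (by omega) hd4; subst this; contradiction)
      | (have := key 2 5 (by norm_num) (by norm_num) (by omega) hd2; contradiction)
      | (have := key 2 7 (by norm_num) (by norm_num) (by omega) hd2; contradiction)
      | (norm_num; done)
  obtain ⟨m, hm, h⟩ := generalWeight_eq_share hq hql hln
  rw [h]
  refine one_le_share (Nat.pos_of_ne_zero ?_)
  rintro rfl
  omega

/-- For `l = 2 * q` the special rule gives `8 / 5` or `12 / 7`, where `share 2 = 1` would be too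
small; otherwise `l / q ≥ 3`. -/
theorem three_halves_le_weight {q : ℕ} (hq57 : q = 5 ∨ q = 7) (hq : ExactDvd q n) (hql : q ∣ l)
    (hln : l ∣ n) (hl : 1 ≤ l) (hlq : l ≠ q) : 3 / 2 ≤ weight n l q := by
  have h6 : l ≠ 6 := by rcases hq57 with rfl | rfl <;> omega
  have h12 : l ≠ 12 := by rcases hq57 with rfl | rfl <;> omega
  rw [weight, if_neg h6, if_neg h12]
  split_ifs with c1 c2
  · obtain rfl : q = 5 := by rcases hq57 with rfl | rfl <;> omega
    norm_num [weightTwice]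
  · obtain rfl : q = 7 := by rcases hq57 with rfl | rfl <;> omega
    norm_num [weightTwice]
  · obtain ⟨m, rfl, h⟩ := generalWeight_eq_share hq hql hln
    rw [h]
    refine three_halves_le_share ?_
    rcases hq57 with rfl | rfl <;> omega

/-- Outside the special lengths, `l / 3` is none of `1, 2, 3`, the last because `9` does not divide
`n`. -/
theorem two_le_weight_three (h3 : ExactDvd 3 n) (h3l : 3 ∣ l) (hln : l ∣ n) (hl : 1 ≤ l)
    (hl3 : l ≠ 3) : 2 ≤ weight n l 3 := by
  rw [weight]
  split_ifs with c1 c2 c3 c4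
  · simp [weightSix, h3]
  · norm_num [weightTwelve, h3]
  · omega
  · omega
  · obtain ⟨m, rfl, h⟩ := generalWeight_eq_share h3 h3l hln
    rw [h]
    have : ¬ 3 ∣ m := fun h => (exactDvd_three_iff.1 h3).2
      ((Nat.mul_dvd_mul_left 3 h).trans hln)
    exact two_le_share (by omega)

theorem four_le_weight_three (h3 : ExactDvd 3 n) (h4 : ExactDvd 4 n) (h12 : 12 ∣ l) (hln : l ∣ n)
    (hl : 1 ≤ l) : 4 ≤ weight n l 3 := by
  have h9 : ¬ 9 ∣ l := fun h => (exactDvd_three_iff.1 h3).2 (h.trans hln)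
  have h8 : ¬ 8 ∣ l := fun h => (exactDvd_four_iff.1 h4).2 (h.trans hln)
  rw [weight]
  split_ifs with c1 c2 c3 c4
  · omega
  · norm_num [weightTwelve, h3]
  · omega
  · omega
  · obtain ⟨m, rfl, h⟩ := generalWeight_eq_share h3 (by omega) hln
    rw [h]
    -- Here `m` is `4` times an odd number prime to `3` and different from `1`, hence at least `20`.
    exact four_le_share (by omega)

theorem one_le_weight_two (h2 : ExactDvd 2 n) (h2l : 2 ∣ l) (hln : l ∣ n) (hl : 1 ≤ l)
    (h6 : l ≠ 6 ∨ ¬ ExactDvd 3 n) : 1 ≤ weight n l 2 := by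
  have h4 : ¬ 4 ∣ l := fun h => (exactDvd_two_iff.1 h2).2 (h.trans hln)
  rw [weight]
  split_ifs with c1 c2 c3 c4
  · norm_num [weightSix, h2, h6.resolve_left (not_not.2 c1)]
  · omega
  · norm_num [weightTwice, h2]
  · norm_num [weightTwice, h2]
  · obtain ⟨m, rfl, h⟩ := generalWeight_eq_share h2 h2l hln
    rw [h]
    exact one_le_share (by omega)

theorem two_le_weight_four (h4 : ExactDvd 4 n) (h4l : 4 ∣ l) (hln : l ∣ n) (hl : 1 ≤ l)
    (hl4 : l ≠ 4) (h12 : l ≠ 12 ∨ ¬ ExactDvd 3 n) : 2 ≤ weight n l 4 := by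
  have h8 : ¬ 8 ∣ l := fun h => (exactDvd_four_iff.1 h4).2 (h.trans hln)
  rw [weight]
  split_ifs with c1 c2 c3 c4
  · omega
  · norm_num [weightTwelve, h12.resolve_left (not_not.2 c2)]
  · omega
  · omega
  · obtain ⟨m, rfl, h⟩ := generalWeight_eq_share h4 h4l hln
    rw [h]
    exact two_le_share (by omega)

theorem one_le_weight_four (h4 : ExactDvd 4 n) (h4l : 4 ∣ l) (hln : l ∣ n) (hl : 1 ≤ l)
    (h12 : l ≠ 12 ∨ ¬ ExactDvd 3 n) : 1 ≤ weight n l 4 := by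
  by_cases hl4 : l = 4
  · rw [weight, if_neg (by omega), if_neg (by omega), if_neg (by omega), if_neg (by omega)]
    obtain ⟨m, rfl, h⟩ := generalWeight_eq_share h4 h4l hln
    rw [h]
    exact one_le_share (by omega)
  · linarith [two_le_weight_four h4 h4l hln hl hl4 h12]

theorem half_le_weight_four (h4 : ExactDvd 4 n) (h2l : 2 ∣ l) (h4l : ¬ 4 ∣ l) (hl : 1 ≤ l)
    (h6 : l ≠ 6 ∨ ¬ ExactDvd 3 n) : 1 / 2 ≤ weight n l 4 := by
  have h2 : ¬ ExactDvd 2 n := fun h => (exactDvd_two_iff.1 h).2 (exactDvd_four_iff.1 h4).1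
  rw [weight]
  split_ifs with c1 c2 c3 c4
  · norm_num [weightSix, h2, h6.resolve_left (not_not.2 c1)]
  · omega
  · norm_num [weightTwice, h2]
  · norm_num [weightTwice, h2]
  · obtain ⟨m, rfl, h⟩ := generalWeight_four_eq_share h2 h2l h4l
    rw [h]
    linarith [one_le_share (m := m) (by omega)]

end Bounds

/-! ### Sums over several distinct cycles -/

section Sums

variable {ι : Type*} {s : Finset ι} {f : ι → ℝ}

theorem add_le_sum (hf : ∀ i, 0 ≤ f i) {i j : ι} (hi : i ∈ s) (hj : j ∈ s) (hij : i ≠ j) :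
    f i + f j ≤ ∑ k ∈ s, f k := by
  classical
  rw [← Finset.sum_pair hij]
  refine Finset.sum_le_sum_of_subset_of_nonneg ?_ fun k _ _ => hf k
  simp [Finset.insert_subset_iff, *]

theorem add_add_le_sum (hf : ∀ i, 0 ≤ f i) {i j k : ι} (hi : i ∈ s) (hj : j ∈ s) (hk : k ∈ s)
    (hij : i ≠ j) (hik : i ≠ k) (hjk : j ≠ k) : f i + f j + f k ≤ ∑ k ∈ s, f k := by
  classical
  have h : f i + f j + f k = ∑ l ∈ {i, j, k}, f l := by
    rw [Finset.sum_insert (by simp [*]), Finset.sum_pair hjk, add_assoc]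
  rw [h]
  refine Finset.sum_le_sum_of_subset_of_nonneg ?_ fun k _ _ => hf k
  simp [Finset.insert_subset_iff, *]

theorem add_add_add_le_sum (hf : ∀ i, 0 ≤ f i) {i j k l : ι} (hi : i ∈ s) (hj : j ∈ s)
    (hk : k ∈ s) (hl : l ∈ s) (hij : i ≠ j) (hik : i ≠ k) (hil : i ≠ l) (hjk : j ≠ k)
    (hjl : j ≠ l) (hkl : k ≠ l) : f i + f j + f k + f l ≤ ∑ k ∈ s, f k := by
  classical
  have h : f i + f j + f k + f l = ∑ m ∈ {i, j, k, l}, f m := by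
    rw [Finset.sum_insert (by simp [*]), Finset.sum_insert (by simp [*]), Finset.sum_pair hkl]
    ring
  rw [h]
  refine Finset.sum_le_sum_of_subset_of_nonneg ?_ fun k _ _ => hf k
  simp [Finset.insert_subset_iff, *]

end Sums

theorem orderOf_toEquiv_eq_card {P : Type*} [PartialOrder P] (g : P ≃o P)
    (hg : Subgroup.zpowers g = ⊤) :
    orderOf (g.toEquiv : Perm P) = Nat.card (P ≃o P) := by
  let φ : (P ≃o P) →* Perm P :=
    { toFun := fun h => h.toEquiv, map_one' := rfl, map_mul' := fun _ _ => rfl }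
  have hφ : Injective φ := fun a b h => RelIso.toEquiv_injective h
  have h1 : orderOf (φ g) = orderOf g := orderOf_injective φ hφ g
  have h2 : Nat.card (Subgroup.zpowers g) = orderOf g := Nat.card_zpowers g
  rw [hg, Subgroup.card_top] at h2
  exact h1.trans h2.symm

/-! ### Summing the weights over the cycles -/

section Cycles

variable {P : Type*} [Fintype P] [DecidableEq P] {σ : Perm P} {n : ℕ}

theorem cycleWeight_nonneg (n q : ℕ) (α : Perm P) : 0 ≤ cycleWeight n q α := weight_nonneg _ _ _

theorem one_le_card_support {α : Perm P} (hα : α ∈ σ.cycleFactorsFinset) :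
    1 ≤ α.support.card :=
  one_le_two.trans (mem_cycleFactorsFinset_iff.1 hα).1.two_le_card_support

theorem exists_cycle_of_exactDvd (hn : orderOf σ = n) {q : ℕ} (hq : ExactDvd q n) :
    ∃ α ∈ σ.cycleFactorsFinset, q ∣ α.support.card := by
  obtain ⟨p, r, hp, hr, rfl, h, -⟩ := hq
  exact exists_mem_cycleFactorsFinset_dvd hp (by omega) (hn ▸ h)

theorem one_le_cycleWeight (hn : orderOf σ = n) {q : ℕ} (hq : ExactDvd q n) {α : Perm P}
    (hα : α ∈ σ.cycleFactorsFinset) (hdvd : q ∣ α.support.card) (h2 : q ≠ 2) (h4 : q ≠ 4) :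
    1 ≤ cycleWeight n q α :=
  one_le_weight hq hdvd (hn ▸ card_support_dvd_orderOf hα) (one_le_card_support hα) h2 h4

variable [PartialOrder P]

theorem exists_cycle_ne_of_exactDvd (hσ : IsCentralAut σ) (hn : orderOf σ = n) {q : ℕ}
    (hq : ExactDvd q n) {α : Perm P} (hα : α ∈ σ.cycleFactorsFinset)
    (hdvd : q ∣ α.support.card) (h2 : 2 < α.support.card) :
    ∃ β ∈ σ.cycleFactorsFinset, β ≠ α ∧ q ∣ β.support.card := by
  obtain ⟨p, r, hp, hr, rfl, -, h⟩ := hq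
  exact exists_cycle_ne hσ hp (by omega) hα hdvd
    (fun h' => h (hn ▸ h'.trans (card_support_dvd_orderOf hα))) h2

theorem exists_third_cycle_of_exactDvd (hσ : IsCentralAut σ) (hn : orderOf σ = n) {q : ℕ}
    (hq : q = 3 ∨ q = 5 ∨ q = 7) (hqn : ExactDvd q n) {α β : Perm P}
    (hα : α ∈ σ.cycleFactorsFinset) (hβ : β ∈ σ.cycleFactorsFinset) (hαβ : α ≠ β)
    (hqα : α.support.card = q) (hqβ : q ∣ β.support.card) :
    ∃ γ ∈ σ.cycleFactorsFinset, γ ≠ α ∧ γ ≠ β ∧ q ∣ γ.support.card := by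
  have hp : q.Prime := by rcases hq with rfl | rfl | rfl <;> norm_num
  have h2 : ∀ γ ∈ σ.cycleFactorsFinset, ¬ q ^ 2 ∣ γ.support.card := fun γ hγ h =>
    ((exactDvd_prime_iff hp).1 hqn).2 (hn ▸ h.trans (card_support_dvd_orderOf hγ))
  exact exists_third_cycle hσ hq hα hβ hαβ (h2 α hα) (h2 β hβ)
    (by rw [hqα]; exact Nat.gcd_eq_left hqβ)

theorem b_le_sum_cycleWeight (hσ : IsCentralAut σ) (hn : orderOf σ = n) {q : ℕ}
    (hq : ExactDvd q n) (h2 : q ≠ 2) (h4 : q ≠ 4) :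
    (b q : ℝ) ≤ ∑ α ∈ σ.cycleFactorsFinset, cycleWeight n q α := by
  have h1 : 1 < q := hq.isPrimePow.one_lt
  obtain ⟨α, hα, hqα⟩ := exists_cycle_of_exactDvd hn hq
  have hα2 : 2 < α.support.card := by
    have := Nat.le_of_dvd (one_le_card_support hα) hqα
    omega
  obtain ⟨β, hβ, hβα, hqβ⟩ := exists_cycle_ne_of_exactDvd hσ hn hq hα hqα hα2
  have hwα := one_le_cycleWeight hn hq hα hqα h2 h4
  have hwβ := one_le_cycleWeight hn hq hβ hqβ h2 h4
  have hsum := add_le_sum (cycleWeight_nonneg n q) hβ hα hβα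
  by_cases h357 : q = 3 ∨ q = 5 ∨ q = 7
  · have hb : b q = 3 := by rcases h357 with rfl | rfl | rfl <;> rfl
    rw [hb]
    have third : ∀ γ ∈ σ.cycleFactorsFinset, γ ≠ α → γ ≠ β → q ∣ γ.support.card →
        ((3 : ℕ) : ℝ) ≤ ∑ α ∈ σ.cycleFactorsFinset, cycleWeight n q α := by
      intro γ hγ hγα hγβ hqγ
      have hwγ := one_le_cycleWeight hn hq hγ hqγ h2 h4
      have := add_add_le_sum (cycleWeight_nonneg n q) hγ hβ hα hγβ hγα hβα
      push_cast
      linarith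
    -- A cycle of length exactly `q` has gcd `q` with any other length divisible by `q`, forcing a
    -- third cycle. If neither length is `q`, both weights are at least `3 / 2`.
    by_cases hαq : α.support.card = q
    · obtain ⟨γ, hγ, h5, h6, h7⟩ :=
        exists_third_cycle_of_exactDvd hσ hn h357 hq hα hβ hβα.symm hαq hqβ
      exact third γ hγ h5 h6 h7
    by_cases hβq : β.support.card = q
    · obtain ⟨γ, hγ, h5, h6, h7⟩ :=
        exists_third_cycle_of_exactDvd hσ hn h357 hq hβ hα hβα hβq hqα
      exact third γ hγ h6 h5 h7
    have key : ∀ γ ∈ σ.cycleFactorsFinset, q ∣ γ.support.card → γ.support.card ≠ q →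
        3 / 2 ≤ cycleWeight n q γ := by
      intro γ hγ hqγ hne
      rcases h357 with rfl | h57
      · have := two_le_weight_three hq hqγ (hn ▸ card_support_dvd_orderOf hγ)
          (one_le_card_support hγ) hne
        rw [cycleWeight]
        linarith
      · exact three_halves_le_weight h57 hq hqγ (hn ▸ card_support_dvd_orderOf hγ)
          (one_le_card_support hγ) hne
    have := key α hα hqα hαq
    have := key β hβ hqβ hβq
    push_cast
    linarith
  · have hb : b q = 2 := by
      rw [b, if_neg (by omega), if_neg h2, if_neg (by omega)]
    rw [hb]
    push_cast
    linarith

/-- The given cycle contributes `2`. A second one contributes another `2`, or has length `3` and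
forces a third, giving `2 + 1 + 1`. -/
theorem four_le_sum_cycleWeight_three (hσ : IsCentralAut σ) (hn : orderOf σ = n)
    (h3 : ExactDvd 3 n) {α : Perm P} (hα : α ∈ σ.cycleFactorsFinset)
    (h3α : 3 ∣ α.support.card) (hα3 : α.support.card ≠ 3) :
    4 ≤ ∑ α ∈ σ.cycleFactorsFinset, cycleWeight n 3 α := by
  have two : ∀ γ ∈ σ.cycleFactorsFinset, 3 ∣ γ.support.card → γ.support.card ≠ 3 →
      2 ≤ cycleWeight n 3 γ := fun γ hγ h h' =>
    two_le_weight_three h3 h (hn ▸ card_support_dvd_orderOf hγ) (one_le_card_support hγ) h'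
  have one : ∀ γ ∈ σ.cycleFactorsFinset, 3 ∣ γ.support.card → 1 ≤ cycleWeight n 3 γ :=
    fun γ hγ h => one_le_cycleWeight hn h3 hγ h (by norm_num) (by norm_num)
  have hpos := one_le_card_support hα
  obtain ⟨β, hβ, hβα, h3β⟩ := exists_cycle_ne_of_exactDvd hσ hn h3 hα h3α (by omega)
  have hwα := two α hα h3α hα3
  by_cases hβ3 : β.support.card = 3
  · obtain ⟨γ, hγ, hγβ, hγα, h3γ⟩ := exists_third_cycle_of_exactDvd hσ hn (Or.inl rfl) h3 hβ hα
      hβα hβ3 h3α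
    have := add_add_le_sum (cycleWeight_nonneg n 3) hγ hβ hα hγβ hγα hβα
    linarith [one β hβ h3β, one γ hγ h3γ]
  · have := add_le_sum (cycleWeight_nonneg n 3) hβ hα hβα
    linarith [two β hβ h3β hβ3]

/-- Either the weights of `4` sum up to at least `3`, or there are two cycles of length `4`, a cycle
of length `6` and one further cycle which has length `6` or in which `4` has weight at least
`1 / 2`. -/
theorem sum_cycleWeight_four_cases (hσ : IsCentralAut σ) (hn : orderOf σ = n)
    (h4 : ExactDvd 4 n)
    (h12 : ∀ α ∈ σ.cycleFactorsFinset, α.support.card ≠ 12 ∨ ¬ ExactDvd 3 n) :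
    3 ≤ ∑ α ∈ σ.cycleFactorsFinset, cycleWeight n 4 α ∨
    ExactDvd 3 n ∧ ∃ α ∈ σ.cycleFactorsFinset, ∃ β ∈ σ.cycleFactorsFinset,
      ∃ γ ∈ σ.cycleFactorsFinset, ∃ δ ∈ σ.cycleFactorsFinset,
      α ≠ β ∧ δ ≠ α ∧ δ ≠ β ∧ α.support.card = 4 ∧ β.support.card = 4 ∧
      γ.support.card = 6 ∧ (δ.support.card = 6 ∨ 1 / 2 ≤ cycleWeight n 4 δ) := by
  have one : ∀ γ ∈ σ.cycleFactorsFinset, 4 ∣ γ.support.card → 1 ≤ cycleWeight n 4 γ :=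
    fun γ hγ h => one_le_weight_four h4 h (hn ▸ card_support_dvd_orderOf hγ)
      (one_le_card_support hγ) (h12 γ hγ)
  have two : ∀ γ ∈ σ.cycleFactorsFinset, 4 ∣ γ.support.card → γ.support.card ≠ 4 →
      2 ≤ cycleWeight n 4 γ :=
    fun γ hγ h h' => two_le_weight_four h4 h (hn ▸ card_support_dvd_orderOf hγ)
      (one_le_card_support hγ) h' (h12 γ hγ)
  have half : ∀ γ ∈ σ.cycleFactorsFinset, 2 ∣ γ.support.card → ¬ 4 ∣ γ.support.card →
      (γ.support.card = 6 ∧ ExactDvd 3 n) ∨ 1 / 2 ≤ cycleWeight n 4 γ := by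
    intro γ hγ h h'
    by_cases h6 : γ.support.card = 6 ∧ ExactDvd 3 n
    · exact Or.inl h6
    · exact Or.inr (half_le_weight_four h4 h h' (one_le_card_support hγ)
        (not_and_or.1 h6))
  obtain ⟨α, hα, h4α⟩ := exists_cycle_of_exactDvd hn h4
  obtain ⟨β, hβ, hβα, h4β⟩ := exists_cycle_ne_of_exactDvd hσ hn h4 hα h4α (by
    have := one_le_card_support hα
    omega)
  have hsum := add_le_sum (cycleWeight_nonneg n 4) hβ hα hβα
  by_cases hα4 : α.support.card = 4
  swap
  · left
    linarith [two α hα h4α hα4, one β hβ h4β]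
  by_cases hβ4 : β.support.card = 4
  swap
  · left
    linarith [two β hβ h4β hβ4, one α hα h4α]
  by_cases hthird : ∃ γ ∈ σ.cycleFactorsFinset, γ ≠ α ∧ γ ≠ β ∧ 4 ∣ γ.support.card
  · left
    obtain ⟨γ, hγ, hγα, hγβ, h4γ⟩ := hthird
    have := add_add_le_sum (cycleWeight_nonneg n 4) hγ hβ hα hγβ hγα hβα
    linarith [one α hα h4α, one β hβ h4β, one γ hγ h4γ]
  push Not at hthird
  obtain ⟨γ, hγ, δ, hδ, hγδ, h2γ, h4γ, h2δ, h4δ⟩ :=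
    exists_two_cycles_of_four hσ hα hβ hβα.symm hα4 hβ4 hthird
  have hne : ∀ {α γ : Perm P}, 4 ∣ α.support.card → ¬ 4 ∣ γ.support.card → γ ≠ α := by
    rintro α γ h1 h2 rfl
    exact h2 h1
  rcases half γ hγ h2γ h4γ with ⟨h6γ, h3⟩ | hwγ
  · exact Or.inr ⟨h3, α, hα, β, hβ, γ, hγ, δ, hδ, hβα.symm,
      hne h4α h4δ, hne h4β h4δ, hα4, hβ4, h6γ, (half δ hδ h2δ h4δ).imp_left And.left⟩
  · rcases half δ hδ h2δ h4δ with ⟨h6δ, h3⟩ | hwδ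
    · exact Or.inr ⟨h3, α, hα, β, hβ, δ, hδ, γ, hγ, hβα.symm,
        hne h4α h4γ, hne h4β h4γ, hα4, hβ4, h6δ, Or.inr hwγ⟩
    · left
      have := add_add_add_le_sum (cycleWeight_nonneg n 4) hγ hδ hβ hα hγδ (hne h4β h4γ)
        (hne h4α h4γ) (hne h4β h4δ) (hne h4α h4δ) hβα
      linarith [one α hα h4α, one β hβ h4β]

theorem b_le_sum_cycleWeight_two_or_four (hσ : IsCentralAut σ) (hn : orderOf σ = n) {q : ℕ}
    (hq : ExactDvd q n) (h3 : ¬ ExactDvd 3 n) (h24 : q = 2 ∨ q = 4) :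
    (b q : ℝ) ≤ ∑ α ∈ σ.cycleFactorsFinset, cycleWeight n q α := by
  rcases h24 with rfl | rfl
  · obtain ⟨α, hα, h2α⟩ := exists_cycle_of_exactDvd hn hq
    have h1 : 1 ≤ cycleWeight n 2 α := one_le_weight_two hq h2α
      (hn ▸ card_support_dvd_orderOf hα) (one_le_card_support hα) (Or.inr h3)
    have h2 := Finset.single_le_sum (fun i _ => cycleWeight_nonneg n 2 i) hα
    have hb : b 2 = 1 := rfl
    rw [hb]
    push_cast
    linarith
  · have hb : b 4 = 3 := rfl
    rw [hb]
    push_cast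
    exact (sum_cycleWeight_four_cases hσ hn hq fun _ _ => Or.inr h3).resolve_right
      fun h => h3 h.1

theorem eleven_le_sum (hσ : IsCentralAut σ) (hn : orderOf σ = n) (h3 : ExactDvd 3 n)
    (h2 : ExactDvd 2 n) :
    11 ≤ ∑ α ∈ σ.cycleFactorsFinset, (2 * cycleWeight n 2 α + 3 * cycleWeight n 3 α) := by
  rw [Finset.sum_add_distrib, ← Finset.mul_sum, ← Finset.mul_sum]
  have hw3 := b_le_sum_cycleWeight hσ hn h3 (by norm_num) (by norm_num)
  have hb : b 3 = 3 := rfl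
  rw [hb] at hw3
  push_cast at hw3
  obtain ⟨α, hα, h2α⟩ := exists_cycle_of_exactDvd hn h2
  -- A cycle of length `6` gives nothing to `2`, but then the weights of `3` alone yield `3 * 4 =
  -- 12`; otherwise the bound is `2 + 9`.
  by_cases h6 : α.support.card = 6
  · have hw4 := four_le_sum_cycleWeight_three hσ hn h3 hα (by omega) (by omega)
    have : 0 ≤ ∑ α ∈ σ.cycleFactorsFinset, cycleWeight n 2 α :=
      Finset.sum_nonneg fun i _ => cycleWeight_nonneg n 2 i
    linarith
  · have h1 : 1 ≤ cycleWeight n 2 α := one_le_weight_two h2 h2α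
      (hn ▸ card_support_dvd_orderOf hα) (one_le_card_support hα) (Or.inl h6)
    have := Finset.single_le_sum (fun i _ => cycleWeight_nonneg n 2 i) hα
    linarith

theorem twenty_le_sum (hσ : IsCentralAut σ) (hn : orderOf σ = n) (h3 : ExactDvd 3 n)
    (h4 : ExactDvd 4 n) :
    20 ≤ ∑ α ∈ σ.cycleFactorsFinset, (4 * cycleWeight n 4 α + 3 * cycleWeight n 3 α) := by
  rw [Finset.sum_add_distrib, ← Finset.mul_sum, ← Finset.mul_sum]
  have hw3 := b_le_sum_cycleWeight hσ hn h3 (by norm_num) (by norm_num)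
  have hb : b 3 = 3 := rfl
  rw [hb] at hw3
  push_cast at hw3
  have hw4 : 0 ≤ ∑ α ∈ σ.cycleFactorsFinset, cycleWeight n 4 α :=
    Finset.sum_nonneg fun i _ => cycleWeight_nonneg n 4 i
  have one3 : ∀ γ ∈ σ.cycleFactorsFinset, 3 ∣ γ.support.card → 1 ≤ cycleWeight n 3 γ :=
    fun γ hγ h => one_le_cycleWeight hn h3 hγ h (by norm_num) (by norm_num)
  have one4 : ∀ γ ∈ σ.cycleFactorsFinset, 4 ∣ γ.support.card → γ.support.card ≠ 12 →
      1 ≤ cycleWeight n 4 γ :=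
    fun γ hγ h h' => one_le_weight_four h4 h (hn ▸ card_support_dvd_orderOf hγ)
      (one_le_card_support hγ) (Or.inl h')
  have four : ∀ γ ∈ σ.cycleFactorsFinset, 12 ∣ γ.support.card → 4 ≤ cycleWeight n 3 γ :=
    fun γ hγ h => four_le_weight_three h3 h4 h (hn ▸ card_support_dvd_orderOf hγ)
      (one_le_card_support hγ)
  -- With a length divisible by `12`: two such give `3 * 8`; otherwise the companion gives `4` and
  -- the weights of `3` sum to at least `6`, in total `4 + 18`.
  by_cases h12 : ∃ α ∈ σ.cycleFactorsFinset, 12 ∣ α.support.card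
  · obtain ⟨α, hα, h12α⟩ := h12
    have hpos := one_le_card_support hα
    have hwα := four α hα h12α
    obtain ⟨β, hβ, hβα, h4β⟩ := exists_cycle_ne_of_exactDvd hσ hn h4 hα (by omega) (by omega)
    by_cases h12β : 12 ∣ β.support.card
    · have := add_le_sum (cycleWeight_nonneg n 3) hβ hα hβα
      linarith [four β hβ h12β]
    · have hwβ := one4 β hβ h4β (by omega)
      have hsum4 := Finset.single_le_sum (fun i _ => cycleWeight_nonneg n 4 i) hβ
      obtain ⟨γ, hγ, hγα, h3γ⟩ := exists_cycle_ne_of_exactDvd hσ hn h3 hα (by omega) (by omega)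
      by_cases hγ3 : γ.support.card = 3
      · obtain ⟨δ, hδ, hδγ, hδα, h3δ⟩ := exists_third_cycle_of_exactDvd hσ hn (Or.inl rfl) h3 hγ
          hα hγα hγ3 (by omega)
        have := add_add_le_sum (cycleWeight_nonneg n 3) hδ hγ hα hδγ hδα hγα
        linarith [one3 γ hγ h3γ, one3 δ hδ h3δ]
      · have hwγ : 2 ≤ cycleWeight n 3 γ :=
          two_le_weight_three h3 h3γ (hn ▸ card_support_dvd_orderOf hγ)
            (one_le_card_support hγ) hγ3
        have := add_le_sum (cycleWeight_nonneg n 3) hγ hα hγα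
        linarith
  · push Not at h12
    rcases sum_cycleWeight_four_cases hσ hn h4
        (fun α hα => Or.inl fun h => h12 α hα (h ▸ dvd_rfl)) with
      h | ⟨-, α, hα, β, hβ, γ, hγ, δ, hδ, hαβ, hδα, hδβ, hα4, hβ4, hγ6, hδ6⟩
    -- Here the bound is `4 * 3 + 3 * 3 = 21`. In the remaining case two cycles of length `4` and
    -- one of length `6` give `4 * 2 + 3 * 4 = 20`, which is where the loss of `1` arises.
    · linarith
    · have hwα := one4 α hα (by omega) (by omega)
      have hwβ := one4 β hβ (by omega) (by omega)
      have h4γ := four_le_sum_cycleWeight_three hσ hn h3 hγ (by omega) (by omega)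
      rcases hδ6 with hδ6 | hwδ
      · have := add_le_sum (cycleWeight_nonneg n 4) hα hβ hαβ
        linarith
      · have := add_add_le_sum (cycleWeight_nonneg n 4) hδ hα hβ hδα hδβ hαβ
        linarith

end Cycles

end PosetAut

theorem mainTheorem2 {P : Type*} [PartialOrder P] [Fintype P] [DecidableEq P]
    (n : ℕ) (hn : Nat.card (P ≃o P) = n)
    (g : P ≃o P) (hg : Subgroup.zpowers g = ⊤) :
    (∀ q : ℕ, PosetAut.ExactDvd q n → q ≠ 2 → q ≠ 4 →
      (PosetAut.b q : ℝ) ≤ ∑ α ∈ PosetAut.cycles g, PosetAut.cycleWeight n q α) ∧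
    (∀ q : ℕ, PosetAut.ExactDvd q n → ¬ PosetAut.ExactDvd 3 n → (q = 2 ∨ q = 4) →
      (PosetAut.b q : ℝ) ≤ ∑ α ∈ PosetAut.cycles g, PosetAut.cycleWeight n q α) ∧
    (PosetAut.ExactDvd 3 n → PosetAut.ExactDvd 2 n →
      (2 * PosetAut.b 2 + 3 * PosetAut.b 3 : ℝ) ≤
          ∑ α ∈ PosetAut.cycles g,
            (2 * PosetAut.cycleWeight n 2 α + 3 * PosetAut.cycleWeight n 3 α) ∧
        (2 * PosetAut.b 2 + 3 * PosetAut.b 3 : ℝ) = 11) ∧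
    (PosetAut.ExactDvd 3 n → PosetAut.ExactDvd 4 n →
      (4 * PosetAut.b 4 + 3 * PosetAut.b 3 - 1 : ℝ) ≤
          ∑ α ∈ PosetAut.cycles g,
            (4 * PosetAut.cycleWeight n 4 α + 3 * PosetAut.cycleWeight n 3 α) ∧
        (4 * PosetAut.b 4 + 3 * PosetAut.b 3 - 1 : ℝ) = 20)
 := by
  have hσ := PosetAut.isCentralAut_of_zpowers_eq_top g hg
  have ho := (PosetAut.orderOf_toEquiv_eq_card g hg).trans hn
  have hb2 : PosetAut.b 2 = 1 := rfl
  have hb3 : PosetAut.b 3 = 3 := rfl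
  have hb4 : PosetAut.b 4 = 3 := rfl
  refine ⟨fun q hq h2 h4 => PosetAut.b_le_sum_cycleWeight hσ ho hq h2 h4,
    fun q hq h3 h24 => PosetAut.b_le_sum_cycleWeight_two_or_four hσ ho hq h3 h24,
    fun h3 h2 => ?_, fun h3 h4 => ?_⟩
  · have h11 : (2 * PosetAut.b 2 + 3 * PosetAut.b 3 : ℝ) = 11 := by
      rw [hb2, hb3]
      norm_num
    exact ⟨h11.le.trans (PosetAut.eleven_le_sum hσ ho h3 h2), h11⟩
  · have h20 : (4 * PosetAut.b 4 + 3 * PosetAut.b 3 - 1 : ℝ) = 20 := by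
      rw [hb4, hb3]
      norm_num
    exact ⟨h20.le.trans (PosetAut.twenty_le_sum hσ ho h3 h4), h20⟩
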